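/- Let $\xi_1,\xi_2,\dots$ be i.i.d. real random variables with symmetric law ($-\xi_1\stackrel{d}{=}\xi_1$) and characteristic function $\phi_{\xi_1}(s)=\mathbb E[e^{is\xi_1}]=1-\nu s^{\beta}+o(s^{\beta})$ as $s\to0^+$, where $0<\beta<2$ and $\nu>0$ (so that $\xi_1$ is in the domain of attraction of a $\beta$-stable law). Let $S_0=0$, $S_n=\xi_1+\dots+\xi_n$, let $\mathcal T=\min\{n>0:S_n>0\}$ be the first-ladder time and $S_{\mathcal T}$ the first-ladder height (leapover). Then $\mathcal T<\infty$ almost surely, $S_{\mathcal T}$ is in the domain of attraction of a (non-degenerate) $\beta/2$-stable law, and $$\mathbb P(S_{\mathcal T}>x)\sim\frac{\sqrt{\nu}}{\Gamma(1-\beta/2)}\,\Phi(1,0)\,x^{-\beta/2}\qquad\text{as }x\to+\infty .$$ Here $\Phi(1,0)=\exp\bigl(\tfrac12\sum_{n\ge1}\tfrac1n\,\mathbb P(S_n=0)\bigr)$, the series being convergent. If $\xi_1$ takes values in $\mathbb Z$ almost surely, the asymptotics hold with $$\Phi(1,0)=\exp\Bigl(-\frac1{2\pi}\int_0^{\pi}\ln\bigl[1-\phi_{\xi_1}(t)\bigr]\,dt\Bigr),$$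 the integrand being integrable on $[0,\pi]$; if the law of $\xi_1$ is continuous (has no atoms), they hold with $\Phi(1,0)=1$. -/

import Mathlib

open MeasureTheory ProbabilityTheory Filter Topology Asymptotics
open scoped BoundedContinuousFunction

/-- The random walk `S_n = ξ_1 + ⋯ + ξ_n`, `S_0 = 0`; the increment `ξ_{k+1}` is `ξ k`. -/
def walk {Ω : Type*} (ξ : ℕ → Ω → ℝ) (n : ℕ) (ω : Ω) : ℝ :=
  ∑ k ∈ Finset.range n, ξ k ω

/-- The first-ladder time `𝒯 = min {n > 0 : S_n > 0}`. It takes the value `0` on the event that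
the set is empty (the theorem asserts that this event is null). -/
noncomputable def ladderTime {Ω : Type*} (ξ : ℕ → Ω → ℝ) (ω : Ω) : ℕ :=
  sInf {n : ℕ | 0 < n ∧ 0 < walk ξ n ω}

/-- The first-ladder height (leapover) `S_𝒯`. -/
noncomputable def leapover {Ω : Type*} (ξ : ℕ → Ω → ℝ) (ω : Ω) : ℝ :=
  walk ξ (ladderTime ξ ω) ω

/-- `m` is a (non-degenerate) `α`-stable law: if `X, X'` are independent with law `m`, then for all
`a, b > 0` there is `d` such that `a X + b X'` and `(a ^ α + b ^ α) ^ (1 / α) X + d` have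
the same law. -/
def IsStableLaw (α : ℝ) (m : Measure ℝ) : Prop :=
  0 < α ∧ α ≤ 2 ∧ IsProbabilityMeasure m ∧ (∀ c : ℝ, m ≠ Measure.dirac c) ∧
    ∀ a b : ℝ, 0 < a → 0 < b → ∃ d : ℝ,
      (m.prod m).map (fun p : ℝ × ℝ => a * p.1 + b * p.2) =
        m.map (fun x : ℝ => (a ^ α + b ^ α) ^ (1 / α) * x + d)

/-- The law `m` is in the domain of attraction of an `α`-stable law: for suitable `a_n > 0` and
`b_n`, and `X_1, X_2, …` i.i.d. with law `m`, the variables `(X_1 + ⋯ + X_n - b_n) / a_n` converge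
in distribution to some `α`-stable law. -/
def InStableDomain (α : ℝ) (m : Measure ℝ) : Prop :=
  IsProbabilityMeasure m ∧
    ∃ L : Measure ℝ, IsStableLaw α L ∧ ∃ a b : ℕ → ℝ, (∀ n, 0 < a n) ∧
      ∀ f : ℝ →ᵇ ℝ,
        Tendsto
          (fun n : ℕ => ∫ x : Fin n → ℝ, f ((∑ i, x i - b n) / a n) ∂(Measure.pi fun _ => m))
          atTop (𝓝 (∫ y, f y ∂L))

/-- `Φ(z, 0) = exp (-(1 / (2 π)) ∫_0^π ln (1 - z φ(t)) dt)`, where `φ` is the characteristic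
function of the law `m`. For a symmetric `m`, `φ` is real-valued, so that `φ` is equal to its
real part. -/
noncomputable def latticePhi (m : Measure ℝ) (z : ℝ) : ℝ :=
  Real.exp (-(1 / (2 * Real.pi)) *
    ∫ t in (0 : ℝ)..Real.pi, Real.log (1 - z * (charFun m t).re))

/-- `exp ((1 / 2) ∑_{n ≥ 1} ℙ(S_n = 0) / n)`: the constant `Φ(1, 0)` of a general real walk. -/
noncomputable def walkPhi {Ω : Type*} [MeasurableSpace Ω] (μ : Measure Ω) (ξ : ℕ → Ω → ℝ) : ℝ :=
  Real.exp ((1 / 2) * ∑' n : ℕ, μ.real {ω | walk ξ (n + 1) ω = 0} / (n + 1))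

/-!
The tail of the first-ladder height is read off from the behaviour of its Laplace transform at the
origin, and the transform is known from fluctuation theory.

*The transform.* On the imaginary axis `1 - z φ`, with `0 < z < 1`, has two factorizations into a
transform of a measure on `(0, ∞)` and one of a measure on `(-∞, 0]`: one from the decomposition of
the walk at its first-ladder time, one from splitting `-log (1 - z φ) = ∑ z ^ n φ ^ n / n` according
to the sign of `S_n`. Uniqueness of such a factorization (`IsTransform.eq_zero_of_eq`) is the
Spitzer–Baxter identity (`spitzer_baxter`), which passes to the limit `z → 1` by Abel's theorem:
`1 - 𝔼[exp (-r S_𝒯); 𝒯 < ∞] = exp (-∑ 𝔼[exp (-r S_n); S_n > 0] / n)`.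

*Symmetry.* For a symmetric walk `2 𝔼[exp (-r S_n); S_n > 0] + ℙ(S_n = 0) = 𝔼[exp (-r |S_n|)]`, and
`𝔼[exp (-r |S_n|)]` is the integral of `φ ^ n` against the Poisson kernel of scale `r`. Summation of
the logarithmic series gives (`one_sub_laplace_leapover_eq`)
`1 - 𝔼[exp (-r S_𝒯); 𝒯 < ∞] = Φ(1, 0) exp (½ ∫ poissonKer r t log (1 - φ t) dt)`.
The Poisson integral of `log (ν |t| ^ β)` is `log (ν r ^ β)`, and the Poisson kernels concentrate at
the origin as `r → 0`, so that the left side is asymptotic to `Φ(1, 0) √ν r ^ (β / 2)`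
(`tendsto_one_sub_laplace_leapover_div`). In particular it tends to `0`, which means that `𝒯` is
finite almost surely.

*Conclusions.* Karamata's Tauberian theorem turns this asymptotic form into that of the tail
(`tendsto_rpow_mul_tail`). Attraction to the one-sided stable law, with Laplace transform
`exp (-c s ^ (β / 2))`, follows from the continuity theorem for Laplace transforms
(`inStableDomain_of_laplace`); both theorems rest on Weierstrass approximation by polynomials in
`exp (-x)`. For integer-valued increments the constant `Φ(1, 0)` is evaluated by Fourier inversion
of `ℙ(S_n = 0)` (`integrable_log_and_walkPhi_eq_latticePhi`), and for atomless increments all these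
probabilities vanish (`walkPhi_eq_one_of_atomless`).
-/

/-! ### Transforms of finite signed measures on a half-line -/

/-- `f` agrees on `D` with the transform `s ↦ ∫ exp (s x) d(ρ - σ)` of a finite signed measure
`ρ - σ` carried by `S`. -/
def IsTransform (S : Set ℝ) (D : Set ℂ) (f : ℂ → ℂ) : Prop :=
  ∃ ρ σ : Measure ℝ, IsFiniteMeasure ρ ∧ IsFiniteMeasure σ ∧ ρ Sᶜ = 0 ∧ σ Sᶜ = 0 ∧
    ∀ s ∈ D, f s = complexMGF id ρ s - complexMGF id σ s

/-- A set `S` closed under addition and a set `D` of exponents `s` for which `x ↦ exp (s x)` is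
bounded by `1` on `S`. -/
structure TransformDomain (S : Set ℝ) (D : Set ℂ) : Prop where
  meas : MeasurableSet S
  add_mem : ∀ x ∈ S, ∀ y ∈ S, x + y ∈ S
  nonpos : ∀ s ∈ D, ∀ x ∈ S, s.re * x ≤ 0

lemma transformDomain_Ioi : TransformDomain (Set.Ioi 0) {s : ℂ | s.re ≤ 0} where
  meas := measurableSet_Ioi
  add_mem _ hx _ hy := add_pos (Set.mem_Ioi.1 hx) hy
  nonpos _ hs _ hx := mul_nonpos_of_nonpos_of_nonneg hs (Set.mem_Ioi.1 hx).le

lemma transformDomain_Iic : TransformDomain (Set.Iic 0) {s : ℂ | s.re = 0} where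
  meas := measurableSet_Iic
  add_mem _ hx _ hy := add_nonpos (Set.mem_Iic.1 hx) (Set.mem_Iic.1 hy)
  nonpos s hs x _ := by simp [show s.re = 0 from hs]

section Transform

variable {S : Set ℝ} {D : Set ℂ}

lemma TransformDomain.norm_exp_le (h : TransformDomain S D) {ρ : Measure ℝ} (hρ : ρ Sᶜ = 0)
    {s : ℂ} (hs : s ∈ D) : ∀ᵐ x ∂ρ, ‖Complex.exp (s * (id x : ℝ))‖ ≤ 1 := by
  have : ∀ᵐ x ∂ρ, x ∈ S := hρ
  filter_upwards [this] with x hx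
  rw [Complex.norm_exp]
  simpa using h.nonpos s hs x hx

lemma TransformDomain.integrable (h : TransformDomain S D) {ρ : Measure ℝ} [IsFiniteMeasure ρ]
    (hρ : ρ Sᶜ = 0) {s : ℂ} (hs : s ∈ D) :
    Integrable (fun x : ℝ => Complex.exp (s * (id x : ℝ))) ρ :=
  Integrable.of_bound (by fun_prop) 1 (h.norm_exp_le hρ hs)

lemma TransformDomain.complexMGF_add (h : TransformDomain S D) {ρ σ : Measure ℝ}
    [IsFiniteMeasure ρ] [IsFiniteMeasure σ] (hρ : ρ Sᶜ = 0) (hσ : σ Sᶜ = 0) {s : ℂ} (hs : s ∈ D) :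
    complexMGF id (ρ + σ) s = complexMGF id ρ s + complexMGF id σ s :=
  integral_add_measure (h.integrable hρ hs) (h.integrable hσ hs)

lemma TransformDomain.conv_compl (h : TransformDomain S D) {ρ σ : Measure ℝ}
    [IsFiniteMeasure ρ] [IsFiniteMeasure σ] (hρ : ρ Sᶜ = 0) (hσ : σ Sᶜ = 0) :
    (ρ ∗ σ) Sᶜ = 0 := by
  have h1 : ∀ᵐ x ∂ρ, x ∈ S := hρ
  have h2 : ∀ᵐ x ∂σ, x ∈ S := hσ
  rw [Measure.conv, Measure.map_apply (by fun_prop) h.meas.compl]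
  have : ∀ᵐ p ∂(ρ.prod σ), p.1 + p.2 ∈ S := by
    filter_upwards [Measure.quasiMeasurePreserving_fst.ae h1,
      Measure.quasiMeasurePreserving_snd.ae h2] with p hp1 hp2
    exact h.add_mem _ hp1 _ hp2
  exact this

lemma TransformDomain.complexMGF_conv (h : TransformDomain S D) {ρ σ : Measure ℝ}
    [IsFiniteMeasure ρ] [IsFiniteMeasure σ] (hρ : ρ Sᶜ = 0) (hσ : σ Sᶜ = 0) {s : ℂ} (hs : s ∈ D) :
    complexMGF id (ρ ∗ σ) s = complexMGF id ρ s * complexMGF id σ s := by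
  have := h.integrable (h.conv_compl hρ hσ) hs
  simp only [complexMGF, id]
  rw [← integral_prod_mul, Measure.conv, integral_map (by fun_prop) (by fun_prop)]
  simp only [← Complex.exp_add, Complex.ofReal_add, mul_add]

lemma TransformDomain.hasSum_complexMGF (h : TransformDomain S D) {ρ : ℕ → Measure ℝ}
    [IsFiniteMeasure (Measure.sum ρ)] (hρ : ∀ n, ρ n Sᶜ = 0) {s : ℂ} (hs : s ∈ D) :
    HasSum (fun n => complexMGF id (ρ n) s) (complexMGF id (Measure.sum ρ) s) :=
  hasSum_integral_measure (h.integrable (by simp [Measure.sum_apply _ h.meas.compl, hρ]) hs)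

/-- A weighted series of transforms of finite measures with summable total masses. -/
lemma TransformDomain.isTransform_hasSum (h : TransformDomain S D) {ρ : ℕ → Measure ℝ}
    [∀ n, IsFiniteMeasure (ρ n)] (hρ : ∀ n, ρ n Sᶜ = 0) (c : ℕ → ℝ)
    (hc : Summable fun n => |c n| * (ρ n).real Set.univ) :
    ∃ f : ℂ → ℂ, IsTransform S D f ∧
      ∀ s ∈ D, HasSum (fun n => (c n : ℂ) * complexMGF id (ρ n) s) (f s) := by
  -- the positive and the negative part of the series are treated separately
  have key : ∀ d : ℕ → ℝ, (∀ n, 0 ≤ d n) → (∀ n, d n ≤ |c n|) →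
      ∃ τ : Measure ℝ, IsFiniteMeasure τ ∧ τ Sᶜ = 0 ∧
        ∀ s ∈ D, HasSum (fun n => (d n : ℂ) * complexMGF id (ρ n) s) (complexMGF id τ s) := by
    intro d hd0 hd
    let θ : ℕ → Measure ℝ := fun n => (ENNReal.ofReal (d n)) • ρ n
    have hsum : Summable fun n => d n * (ρ n).real Set.univ :=
      Summable.of_nonneg_of_le (fun n => mul_nonneg (hd0 n) measureReal_nonneg)
        (fun n => mul_le_mul_of_nonneg_right (hd n) measureReal_nonneg) hc
    have hfin : IsFiniteMeasure (Measure.sum θ) := by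
      refine ⟨?_⟩
      rw [Measure.sum_apply _ MeasurableSet.univ]
      have : ∀ n, θ n Set.univ = ENNReal.ofReal (d n * (ρ n).real Set.univ) := by
        intro n
        simp only [θ, Measure.smul_apply, smul_eq_mul]
        rw [ENNReal.ofReal_mul (hd0 n), ofReal_measureReal]
      simp_rw [this]
      exact hsum.tsum_ofReal_lt_top
    have hθ : ∀ n, θ n Sᶜ = 0 := fun n => by simp [θ, hρ n]
    refine ⟨Measure.sum θ, hfin, by simp [Measure.sum_apply _ h.meas.compl, hθ], fun s hs => ?_⟩
    have := h.hasSum_complexMGF hθ hs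
    convert this using 2 with n
    simp only [θ, complexMGF, integral_smul_measure, ENNReal.toReal_ofReal (hd0 n)]
    simp
  obtain ⟨τ, hτ, hτS, hτs⟩ := key (fun n => max (c n) 0) (fun n => le_max_right _ _)
    (fun n => max_le (le_abs_self _) (abs_nonneg _))
  obtain ⟨τ', hτ', hτS', hτs'⟩ := key (fun n => max (-c n) 0) (fun n => le_max_right _ _)
    (fun n => max_le (neg_le_abs _) (abs_nonneg _))
  refine ⟨fun s => complexMGF id τ s - complexMGF id τ' s,
    ⟨τ, τ', hτ, hτ', hτS, hτS', fun s _ => rfl⟩, fun s hs => ?_⟩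
  refine ((hτs s hs).sub (hτs' s hs)).congr_fun fun n => ?_
  rw [← sub_mul, ← Complex.ofReal_sub, max_zero_sub_max_neg_zero_eq_self]

lemma IsTransform.neg {f : ℂ → ℂ} (hf : IsTransform S D f) : IsTransform S D (fun s => -f s) := by
  obtain ⟨ρ, σ, h1, h2, h3, h4, h5⟩ := hf
  exact ⟨σ, ρ, h2, h1, h4, h3, fun s hs => by simp only [h5 s hs, neg_sub]⟩

lemma IsTransform.congr {f g : ℂ → ℂ} (hf : IsTransform S D f) (h : ∀ s ∈ D, g s = f s) :
    IsTransform S D g := by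
  obtain ⟨ρ, σ, h1, h2, h3, h4, h5⟩ := hf
  exact ⟨ρ, σ, h1, h2, h3, h4, fun s hs => by rw [h s hs, h5 s hs]⟩

lemma TransformDomain.add (h : TransformDomain S D) {f g : ℂ → ℂ} (hf : IsTransform S D f)
    (hg : IsTransform S D g) : IsTransform S D (fun s => f s + g s) := by
  obtain ⟨ρ, σ, h1, h2, h3, h4, h5⟩ := hf
  obtain ⟨ρ', σ', h1', h2', h3', h4', h5'⟩ := hg
  refine ⟨ρ + ρ', σ + σ', inferInstance, inferInstance, by simp [h3, h3'], by simp [h4, h4'],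
    fun s hs => ?_⟩
  rw [h.complexMGF_add h3 h3' hs, h.complexMGF_add h4 h4' hs]
  simp only [h5 s hs, h5' s hs]
  ring

lemma TransformDomain.mul (h : TransformDomain S D) {f g : ℂ → ℂ} (hf : IsTransform S D f)
    (hg : IsTransform S D g) : IsTransform S D (fun s => f s * g s) := by
  obtain ⟨ρ, σ, h1, h2, h3, h4, h5⟩ := hf
  obtain ⟨ρ', σ', h1', h2', h3', h4', h5'⟩ := hg
  have a1 := h.conv_compl h3 h3'
  have a2 := h.conv_compl h4 h4'
  have a3 := h.conv_compl h3 h4'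
  have a4 := h.conv_compl h4 h3'
  refine ⟨ρ ∗ ρ' + σ ∗ σ', ρ ∗ σ' + σ ∗ ρ', inferInstance, inferInstance, by simp [a1, a2],
    by simp [a3, a4], fun s hs => ?_⟩
  rw [h.complexMGF_add a1 a2 hs, h.complexMGF_add a3 a4 hs,
    h.complexMGF_conv h3 h3' hs, h.complexMGF_conv h4 h4' hs, h.complexMGF_conv h3 h4' hs,
    h.complexMGF_conv h4 h3' hs]
  simp only [h5 s hs, h5' s hs]
  ring

/-- The `(n + 1)`-fold convolution power of `ρ`; the shift avoids the unit mass at `0`, which is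
not carried by `(0, ∞)`. -/
noncomputable def convPow (ρ : Measure ℝ) : ℕ → Measure ℝ
  | 0 => ρ
  | n + 1 => ρ ∗ convPow ρ n

instance isFiniteMeasure_convPow (ρ : Measure ℝ) [IsFiniteMeasure ρ] (n : ℕ) :
    IsFiniteMeasure (convPow ρ n) := by
  induction n with
  | zero => assumption
  | succ n ih => rw [convPow]; infer_instance

lemma TransformDomain.convPow_compl (h : TransformDomain S D) {ρ : Measure ℝ} [IsFiniteMeasure ρ]
    (hρ : ρ Sᶜ = 0) (n : ℕ) : convPow ρ n Sᶜ = 0 := by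
  induction n with
  | zero => exact hρ
  | succ n ih => exact h.conv_compl hρ ih

lemma TransformDomain.complexMGF_convPow (h : TransformDomain S D) {ρ : Measure ℝ}
    [IsFiniteMeasure ρ] (hρ : ρ Sᶜ = 0) {s : ℂ} (hs : s ∈ D) (n : ℕ) :
    complexMGF id (convPow ρ n) s = complexMGF id ρ s ^ (n + 1) := by
  induction n with
  | zero => simp [convPow]
  | succ n ih => rw [convPow, h.complexMGF_conv hρ (h.convPow_compl hρ n) hs, ih]; ring

lemma measureReal_convPow_univ (ρ : Measure ℝ) [IsFiniteMeasure ρ] (n : ℕ) :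
    (convPow ρ n).real Set.univ = ρ.real Set.univ ^ (n + 1) := by
  induction n with
  | zero => simp [convPow]
  | succ n ih =>
    rw [convPow, Measure.conv, map_measureReal_apply (by fun_prop) MeasurableSet.univ,
      Set.preimage_univ, ← Set.univ_prod_univ, measureReal_prod_prod, ih]
    ring

/-- If `f` is the transform of a finite measure `ρ`, then `exp (±f) - 1` is the transform of a
finite signed measure, because of the exponential series of convolution powers of `ρ`. -/
lemma TransformDomain.exp_mul_sub_one (h : TransformDomain S D) {ρ : Measure ℝ}
    [IsFiniteMeasure ρ] (hρ : ρ Sᶜ = 0) (ε : ℝ) (hε : |ε| = 1) :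
    IsTransform S D (fun s => Complex.exp (ε * complexMGF id ρ s) - 1) := by
  have hc : Summable fun n : ℕ =>
      |ε ^ (n + 1) / ((n + 1).factorial : ℝ)| * (convPow ρ n).real Set.univ := by
    have := (Real.summable_pow_div_factorial (ρ.real Set.univ))
    rw [← summable_nat_add_iff 1] at this
    refine this.congr fun n => ?_
    rw [measureReal_convPow_univ, abs_div, abs_pow, hε]
    simp [div_eq_mul_inv, mul_comm]
  obtain ⟨f, hf, hfs⟩ := h.isTransform_hasSum (h.convPow_compl hρ) _ hc
  refine hf.congr fun s hs => ?_
  have h1 := hfs s hs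
  have h2 := NormedSpace.expSeries_div_hasSum_exp ((ε : ℂ) * complexMGF id ρ s)
  rw [← Complex.exp_eq_exp_ℂ, ← hasSum_nat_add_iff' 1] at h2
  refine HasSum.unique ?_ h1
  rw [Finset.sum_range_one, pow_zero, Nat.factorial_zero, Nat.cast_one, div_one] at h2
  refine h2.congr_fun fun n => ?_
  rw [h.complexMGF_convPow hρ hs]
  push_cast
  rw [mul_pow]
  ring

lemma TransformDomain.exp_sub_one (h : TransformDomain S D) {f : ℂ → ℂ} (hf : IsTransform S D f) :
    IsTransform S D (fun s => Complex.exp (f s) - 1) := by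
  obtain ⟨ρ, σ, h1, h2, h3, h4, h5⟩ := hf
  have hu := h.exp_mul_sub_one h3 1 (by simp)
  have hv := h.exp_mul_sub_one h4 (-1) (by simp)
  refine (h.add (h.add (h.mul hu hv) hu) hv).congr fun s hs => ?_
  rw [h5 s hs, sub_eq_add_neg (complexMGF id ρ s), Complex.exp_add]
  push_cast
  rw [one_mul, neg_one_mul]
  ring

end Transform

/-- A signed measure on `(0, ∞)` and one on `(-∞, 0]` with the same characteristic function
vanish: they are equal, and they are carried by disjoint sets. This is the uniqueness of the
Wiener–Hopf factorization. -/
lemma IsTransform.eq_zero_of_eq {f g : ℂ → ℂ}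
    (hf : IsTransform (Set.Ioi 0) {s : ℂ | s.re ≤ 0} f)
    (hg : IsTransform (Set.Iic 0) {s : ℂ | s.re = 0} g) (hfg : ∀ s : ℂ, s.re = 0 → f s = g s)
    {s : ℂ} (hs : s.re ≤ 0) : f s = 0 := by
  obtain ⟨ρ, σ, h1, h2, h3, h4, h5⟩ := hf
  obtain ⟨ρ', σ', h1', h2', h3', h4', h5'⟩ := hg
  have hchar : ρ + σ' = ρ' + σ := by
    apply Measure.ext_of_charFun
    ext t
    have ht : ((t : ℂ) * Complex.I).re = 0 := by simp
    have e1 := h5 (t * Complex.I) ht.le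
    have e2 := h5' (t * Complex.I) ht
    rw [hfg _ ht, e2] at e1
    simp only [complexMGF_id_mul_I] at e1
    have hadd : ∀ α β : Measure ℝ, IsFiniteMeasure α → IsFiniteMeasure β →
        charFun (α + β) t = charFun α t + charFun β t := by
      intro α β _ _
      simp only [charFun_apply_real]
      refine integral_add_measure ?_ ?_ <;>
      · refine Integrable.of_bound (by fun_prop) 1 (ae_of_all _ fun x => ?_)
        rw [← Complex.ofReal_mul, Complex.norm_exp_ofReal_mul_I]
    rw [hadd _ _ h1 h2', hadd _ _ h1' h2]
    linear_combination -e1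
  have hρσ : ρ = σ := by
    have := congrArg (fun m : Measure ℝ => m.restrict (Set.Ioi 0)) hchar
    simp only [Measure.restrict_add] at this
    rw [Measure.restrict_eq_self_of_ae_mem (s := Set.Ioi 0) (μ := ρ) h3,
      Measure.restrict_eq_self_of_ae_mem (s := Set.Ioi 0) (μ := σ) h4,
      Measure.restrict_eq_zero.2 (by simpa using h4'),
      Measure.restrict_eq_zero.2 (by simpa using h3')] at this
    simpa using this
  rw [h5 s hs, hρσ, sub_self]

/-! ### The walk until its first-ladder time -/

section Walk

variable {Ω : Type*} {mΩ : MeasurableSpace Ω} {μ : Measure Ω} {ξ : ℕ → Ω → ℝ}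

/-- The event `𝒯 > n`: the walk has not been positive up to time `n`. -/
def stayEvent (ξ : ℕ → Ω → ℝ) (n : ℕ) : Set Ω := {ω | ∀ k ≤ n, walk ξ k ω ≤ 0}

/-- The event `𝒯 = n + 1`. -/
def ladderEvent (ξ : ℕ → Ω → ℝ) (n : ℕ) : Set Ω := stayEvent ξ n ∩ {ω | 0 < walk ξ (n + 1) ω}

@[fun_prop]
lemma measurable_walk (hmeas : ∀ k, Measurable (ξ k)) (n : ℕ) : Measurable (walk ξ n) :=
  Finset.measurable_fun_sum _ fun k _ => hmeas k

lemma stayEvent_eq_iInter (n : ℕ) :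
    stayEvent ξ n = ⋂ k, ⋂ (_ : k ≤ n), {ω | walk ξ k ω ≤ 0} := by
  ext
  simp [stayEvent]

lemma measurableSet_stayEvent (hmeas : ∀ k, Measurable (ξ k)) (n : ℕ) :
    MeasurableSet (stayEvent ξ n) := by
  rw [stayEvent_eq_iInter]
  exact MeasurableSet.iInter fun k => MeasurableSet.iInter fun _ =>
    measurableSet_le (measurable_walk hmeas k) measurable_const

lemma measurableSet_ladderEvent (hmeas : ∀ k, Measurable (ξ k)) (n : ℕ) :
    MeasurableSet (ladderEvent ξ n) :=
  (measurableSet_stayEvent hmeas n).inter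
    (measurableSet_lt measurable_const (measurable_walk hmeas _))

lemma stayEvent_eq_union (n : ℕ) :
    stayEvent ξ n = stayEvent ξ (n + 1) ∪ ladderEvent ξ n := by
  ext ω
  simp only [stayEvent, ladderEvent, Set.mem_union, Set.mem_inter_iff, Set.mem_ofPred_eq]
  constructor
  · intro h
    rcases le_or_gt (walk ξ (n + 1) ω) 0 with h0 | h0
    · left
      intro k hk
      rcases Nat.lt_or_eq_of_le hk with hk | rfl
      · exact h k (by omega)
      · exact h0
    · exact Or.inr ⟨h, h0⟩
  · rintro (h | h)
    · exact fun k hk => h k (by omega)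
    · exact h.1

lemma disjoint_stayEvent_ladderEvent (n : ℕ) :
    Disjoint (stayEvent ξ (n + 1)) (ladderEvent ξ n) := by
  rw [Set.disjoint_left]
  intro ω h1 h2
  exact (lt_irrefl _ ((h1 (n + 1) le_rfl).trans_lt h2.2))

/-- The σ-algebra of the first `n` steps. -/
@[reducible]
def pastAlgebra (ξ : ℕ → Ω → ℝ) (n : ℕ) : MeasurableSpace Ω :=
  ⨆ i ∈ Set.Iio n, MeasurableSpace.comap (ξ i) Real.measurableSpace

lemma pastAlgebra_le (hmeas : ∀ k, Measurable (ξ k)) (n : ℕ) : pastAlgebra ξ n ≤ mΩ :=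
  iSup₂_le fun i _ => (hmeas i).comap_le

lemma measurable_past_walk {k n : ℕ} (hk : k ≤ n) : Measurable[pastAlgebra ξ n] (walk ξ k) := by
  refine @Finset.measurable_fun_sum _ _ _ _ _ _ (pastAlgebra ξ n) _ _ fun j hj => ?_
  have : MeasurableSpace.comap (ξ j) Real.measurableSpace ≤ pastAlgebra ξ n :=
    le_iSup₂_of_le (f := fun i (_ : i ∈ Set.Iio n) => MeasurableSpace.comap (ξ i) _)
      j ((Finset.mem_range.1 hj).trans_le hk) le_rfl
  exact (comap_measurable (ξ j)).mono this le_rfl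

lemma measurableSet_past_stayEvent (n : ℕ) : MeasurableSet[pastAlgebra ξ n] (stayEvent ξ n) := by
  rw [stayEvent_eq_iInter]
  exact MeasurableSet.iInter fun k => MeasurableSet.iInter fun hk =>
    measurable_past_walk hk measurableSet_Iic

/-- An integral over an event of the first `n` steps splits off the step `n + 1`. -/
lemma integral_past_mul_step [IsProbabilityMeasure μ] (hmeas : ∀ k, Measurable (ξ k))
    (hindep : iIndepFun ξ μ) (hident : ∀ k, IdentDistrib (ξ k) (ξ 0) μ μ) (n : ℕ) {E : Set Ω}
    (hE : MeasurableSet[pastAlgebra ξ n] E) (s : ℂ) :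
    ∫ ω in E, Complex.exp (s * walk ξ (n + 1) ω) ∂μ =
      (∫ ω in E, Complex.exp (s * walk ξ n ω) ∂μ) * complexMGF id (μ.map (ξ 0)) s := by
  have hmle := pastAlgebra_le hmeas n
  have hind : Indep (pastAlgebra ξ n) (MeasurableSpace.comap (ξ n) Real.measurableSpace) μ := by
    have := indep_iSup_of_disjoint (fun i => (hmeas i).comap_le) hindep
      (S := Set.Iio n) (T := {n}) (by simp)
    simpa [pastAlgebra] using this
  have hX : Measurable[pastAlgebra ξ n] (E.indicator fun ω => Complex.exp (s * walk ξ n ω)) := by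
    have h1 : Measurable fun x : ℝ => Complex.exp (s * x) := by fun_prop
    have h2 : Measurable[pastAlgebra ξ n] fun ω => Complex.exp (s * walk ξ n ω) :=
      h1.comp (measurable_past_walk le_rfl)
    exact h2.indicator hE
  have hi : IndepFun (E.indicator fun ω => Complex.exp (s * walk ξ n ω))
      (fun ω => Complex.exp (s * ξ n ω)) μ := by
    have h1 : IndepFun (E.indicator fun ω => Complex.exp (s * walk ξ n ω)) (ξ n) μ :=
      indep_of_indep_of_le_left hind hX.comap_le
    exact h1.comp (φ := id) (ψ := fun x : ℝ => Complex.exp (s * x)) measurable_id (by fun_prop)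
  have key := hi.integral_fun_mul_eq_mul_integral (hX.mono hmle le_rfl).aestronglyMeasurable
    (by have := hmeas n; fun_prop)
  have hid : ∫ ω, Complex.exp (s * ξ n ω) ∂μ = complexMGF id (μ.map (ξ 0)) s := by
    rw [complexMGF_id_map (hmeas 0).aemeasurable]
    exact ((hident n).comp (u := fun x : ℝ => Complex.exp (s * x)) (by fun_prop)).integral_eq
  rw [hid, integral_indicator (hmle _ hE)] at key
  rw [← key, ← integral_indicator (hmle _ hE)]
  congr 1 with ω
  by_cases hω : ω ∈ E
  · simp only [Set.indicator_of_mem hω, walk, Finset.sum_range_succ]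
    push_cast
    rw [mul_add, Complex.exp_add]
  · simp [Set.indicator_of_notMem hω]

lemma complexMGF_map_restrict (hmeas : ∀ k, Measurable (ξ k)) (E : Set Ω) (n : ℕ) (s : ℂ) :
    complexMGF id ((μ.restrict E).map (walk ξ n)) s =
      ∫ ω in E, Complex.exp (s * walk ξ n ω) ∂μ := by
  rw [complexMGF_id_map (measurable_walk hmeas n).aemeasurable]
  rfl

lemma complexMGF_map_restrict_neg (hmeas : ∀ k, Measurable (ξ k)) (E : Set Ω) (n : ℕ) (r : ℝ) :
    complexMGF id ((μ.restrict E).map (walk ξ n)) (((-r : ℝ) : ℂ)) =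
      ((∫ ω in E, Real.exp (-r * walk ξ n ω) ∂μ : ℝ) : ℂ) := by
  rw [complexMGF_id_map (measurable_walk hmeas n).aemeasurable, complexMGF_ofReal]
  rfl

lemma complexMGF_map_walk [IsProbabilityMeasure μ] (hmeas : ∀ k, Measurable (ξ k))
    (hindep : iIndepFun ξ μ) (hident : ∀ k, IdentDistrib (ξ k) (ξ 0) μ μ) (n : ℕ) (s : ℂ) :
    ∫ ω, Complex.exp (s * walk ξ n ω) ∂μ = complexMGF id (μ.map (ξ 0)) s ^ n := by
  induction n with
  | zero => simp [walk]
  | succ n ih =>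
    have := integral_past_mul_step hmeas hindep hident n (@MeasurableSet.univ _ (_)) s
    rw [setIntegral_univ, setIntegral_univ, ih] at this
    rw [this, pow_succ]

lemma charFun_map_walk [IsProbabilityMeasure μ] (hmeas : ∀ k, Measurable (ξ k))
    (hindep : iIndepFun ξ μ) (hident : ∀ k, IdentDistrib (ξ k) (ξ 0) μ μ) (n : ℕ) (t : ℝ) :
    charFun (μ.map (walk ξ n)) t = charFun (μ.map (ξ 0)) t ^ n := by
  rw [← complexMGF_id_mul_I, ← complexMGF_id_mul_I, ← complexMGF_map_walk hmeas hindep hident,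
    complexMGF_id_map (measurable_walk hmeas n).aemeasurable]
  rfl

lemma summable_of_le_geometric {z : ℝ} (hz0 : 0 < z) (hz1 : z < 1) {c u : ℕ → ℝ}
    (hu0 : ∀ n, 0 ≤ u n) (hu : ∀ n, u n ≤ 1) (hc : ∀ n, |c n| ≤ z ^ (n + 1)) :
    Summable fun n => |c n| * u n := by
  refine Summable.of_nonneg_of_le (fun n => mul_nonneg (abs_nonneg _) (hu0 n)) (fun n => ?_)
    ((summable_nat_add_iff 1).2 (summable_geometric_of_lt_one hz0.le hz1))
  calc |c n| * u n ≤ z ^ (n + 1) * 1 :=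
        mul_le_mul (hc n) (hu n) (hu0 n) (pow_nonneg hz0.le _)
    _ = z ^ (n + 1) := mul_one _

lemma abs_pow_div_le {z : ℝ} (hz0 : 0 < z) (n : ℕ) : |z ^ (n + 1) / (n + 1)| ≤ z ^ (n + 1) := by
  rw [abs_of_nonneg (by positivity)]
  exact div_le_self (by positivity) (by linarith [Nat.cast_nonneg (α := ℝ) n])

/-- The **Spitzer–Baxter identity** for the first strict ascending ladder point. In the proof `Q`
and `P` are the transforms of `∑ z ^ n ℙ(S_n ∈ ·, 𝒯 = n)` and `∑ z ^ n ℙ(S_n ∈ ·, 𝒯 > n)`, and `A`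
and `B` those of `∑ z ^ n / n ℙ(S_n ∈ ·)` on `(0, ∞)` and on `(-∞, 0]`, where `n ≥ 1`. Both sides
of `(1 - Q) exp A = (1 + P) exp (-B)` are `1` plus the transform of a signed measure, carried by
`(0, ∞)` on the left and by `(-∞, 0]` on the right; hence both are equal to `1`. -/
theorem spitzer_baxter [IsProbabilityMeasure μ] (hmeas : ∀ k, Measurable (ξ k))
    (hindep : iIndepFun ξ μ) (hident : ∀ k, IdentDistrib (ξ k) (ξ 0) μ μ) {z : ℝ} (hz0 : 0 < z)
    (hz1 : z < 1) {r : ℝ} (hr : 0 ≤ r) :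
    1 - ∑' n : ℕ, z ^ (n + 1) * ∫ ω in ladderEvent ξ n, Real.exp (-r * walk ξ (n + 1) ω) ∂μ =
      Real.exp (-∑' n : ℕ, z ^ (n + 1) / (n + 1) *
        ∫ ω in {ω | 0 < walk ξ (n + 1) ω}, Real.exp (-r * walk ξ (n + 1) ω) ∂μ) := by
  have hw := fun n => measurable_walk hmeas n
  have hpos : ∀ n, MeasurableSet {ω | 0 < walk ξ n ω} := fun n =>
    measurableSet_lt measurable_const (hw n)
  have hnonpos : ∀ n, MeasurableSet {ω | walk ξ n ω ≤ 0} := fun n =>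
    measurableSet_le (hw n) measurable_const
  have hmass : ∀ (E : Set Ω) (n : ℕ), ((μ.restrict E).map (walk ξ n)).real Set.univ ≤ 1 := by
    intro E n
    rw [map_measureReal_apply (hw n) MeasurableSet.univ]
    simp
  have carried : ∀ (E : Set Ω) (n : ℕ) (S : Set ℝ), MeasurableSet E → MeasurableSet S →
      (∀ ω ∈ E, walk ξ n ω ∈ S) → ((μ.restrict E).map (walk ξ n)) Sᶜ = 0 := by
    intro E n S hE hS h
    rw [Measure.map_apply (hw n) hS.compl, Measure.restrict_apply (hw n hS.compl)]
    convert measure_empty (μ := μ)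
    ext ω
    simp only [Set.mem_inter_iff, Set.mem_preimage, Set.mem_compl_iff, Set.mem_empty_iff_false,
      iff_false, not_and]
    exact fun h1 h2 => h1 (h ω h2)
  have hzn : ∀ n : ℕ, |z ^ (n + 1)| ≤ z ^ (n + 1) := fun n => (abs_of_nonneg (by positivity)).le
  -- the transforms of the four series
  obtain ⟨Q, hQ, hQs⟩ := transformDomain_Ioi.isTransform_hasSum
    (ρ := fun n => (μ.restrict (ladderEvent ξ n)).map (walk ξ (n + 1)))
    (fun n => carried _ _ _ (measurableSet_ladderEvent hmeas n) measurableSet_Ioi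
      fun ω hω => hω.2) (fun n => z ^ (n + 1))
    (summable_of_le_geometric hz0 hz1 (fun n => measureReal_nonneg) (fun n => hmass _ _) hzn)
  obtain ⟨A, hA, hAs⟩ := transformDomain_Ioi.isTransform_hasSum
    (ρ := fun n => (μ.restrict {ω | 0 < walk ξ (n + 1) ω}).map (walk ξ (n + 1)))
    (fun n => carried _ _ _ (hpos _) measurableSet_Ioi
      fun ω hω => hω) (fun n => z ^ (n + 1) / (n + 1))
    (summable_of_le_geometric hz0 hz1 (fun n => measureReal_nonneg) (fun n => hmass _ _)
      (abs_pow_div_le hz0))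
  obtain ⟨P, hP, hPs⟩ := transformDomain_Iic.isTransform_hasSum
    (ρ := fun n => (μ.restrict (stayEvent ξ (n + 1))).map (walk ξ (n + 1)))
    (fun n => carried _ _ _ (measurableSet_stayEvent hmeas _) measurableSet_Iic
      fun ω hω => hω _ le_rfl) (fun n => z ^ (n + 1))
    (summable_of_le_geometric hz0 hz1 (fun n => measureReal_nonneg) (fun n => hmass _ _) hzn)
  obtain ⟨B, hB, hBs⟩ := transformDomain_Iic.isTransform_hasSum
    (ρ := fun n => (μ.restrict {ω | walk ξ (n + 1) ω ≤ 0}).map (walk ξ (n + 1)))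
    (fun n => carried _ _ _ (hnonpos _) measurableSet_Iic
      fun ω hω => hω) (fun n => z ^ (n + 1) / (n + 1))
    (summable_of_le_geometric hz0 hz1 (fun n => measureReal_nonneg) (fun n => hmass _ _)
      (abs_pow_div_le hz0))
  simp only [complexMGF_map_restrict hmeas] at hPs hBs
  -- on the imaginary axis all transforms exist, and both factorizations of `1 - z φ` are at hand
  have haxis : ∀ s : ℂ, s.re = 0 →
      (1 - Q s) * Complex.exp (A s) - 1 = (1 + P s) * Complex.exp (-B s) - 1 := by
    intro s hs
    have hQ' := hQs s hs.le
    have hA' := hAs s hs.le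
    simp only [complexMGF_map_restrict hmeas] at hQ' hA'
    have hP' := hPs s hs
    have hB' := hBs s hs
    set φ := complexMGF id (μ.map (ξ 0)) s with hφ
    have hbd : ∀ (n : ℕ) (ω : Ω), ‖Complex.exp (s * walk ξ n ω)‖ ≤ 1 := by
      intro n ω
      rw [Complex.norm_exp]
      simp [hs]
    have hint : ∀ n, Integrable (fun ω => Complex.exp (s * walk ξ n ω)) μ := by
      intro n
      have := hw n
      exact Integrable.of_bound (by fun_prop) 1 (ae_of_all _ (hbd n))
    -- the step `n + 1` of a walk that has stayed nonpositive ends in `𝒯 > n + 1` or in `𝒯 = n + 1`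
    have hrec : ∀ n, (∫ ω in stayEvent ξ n, Complex.exp (s * walk ξ n ω) ∂μ) * φ =
        (∫ ω in stayEvent ξ (n + 1), Complex.exp (s * walk ξ (n + 1) ω) ∂μ) +
          ∫ ω in ladderEvent ξ n, Complex.exp (s * walk ξ (n + 1) ω) ∂μ := by
      intro n
      rw [← integral_past_mul_step hmeas hindep hident n (measurableSet_past_stayEvent n),
        stayEvent_eq_union, setIntegral_union (disjoint_stayEvent_ladderEvent n)
          (measurableSet_ladderEvent hmeas n) (hint _).integrableOn (hint _).integrableOn]
    have h1 : HasSum (fun n : ℕ => (((z ^ (n + 1) : ℝ)) : ℂ) *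
        ((∫ ω in stayEvent ξ n, Complex.exp (s * walk ξ n ω) ∂μ) * φ)) (P s + Q s) := by
      refine (hP'.add hQ').congr_fun fun n => ?_
      rw [hrec n, mul_add]
    have h2 : HasSum (fun n : ℕ => (((z ^ n : ℝ)) : ℂ) *
        (∫ ω in stayEvent ξ n, Complex.exp (s * walk ξ n ω) ∂μ)) (1 + P s) := by
      rw [← hasSum_nat_add_iff' 1]
      have h0 : stayEvent ξ 0 = Set.univ := by ext; simp [stayEvent, walk]
      rw [Finset.sum_range_one, h0]
      simpa [walk] using hP'
    have h3 : P s + Q s = z * φ * (1 + P s) := by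
      refine h1.unique ((h2.mul_left (z * φ)).congr_fun fun n => ?_)
      push_cast
      ring
    -- `A + B` is the power series of `-log (1 - z φ)`
    have hφ1 : ‖(z : ℂ) * φ‖ < 1 := by
      have : ‖φ‖ ≤ 1 := by
        rw [hφ, complexMGF_id_map (hmeas 0).aemeasurable]
        have := norm_integral_le_of_norm_le_const (μ := μ) (C := 1)
          (f := fun ω => Complex.exp (s * ξ 0 ω))
          (ae_of_all _ fun ω => by simpa [walk] using hbd 1 ω)
        simpa [complexMGF] using this
      rw [norm_mul, Complex.norm_real, Real.norm_of_nonneg hz0.le]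
      calc z * ‖φ‖ ≤ z * 1 := mul_le_mul_of_nonneg_left this hz0.le
        _ < 1 := by linarith
    have h4 : HasSum (fun n : ℕ => ((z : ℂ) * φ) ^ (n + 1) / ((n : ℂ) + 1)) (A s + B s) := by
      refine (hA'.add hB').congr_fun fun n => ?_
      have hun : ∫ ω, Complex.exp (s * walk ξ (n + 1) ω) ∂μ =
          (∫ ω in {ω | 0 < walk ξ (n + 1) ω}, Complex.exp (s * walk ξ (n + 1) ω) ∂μ) +
            ∫ ω in {ω | walk ξ (n + 1) ω ≤ 0}, Complex.exp (s * walk ξ (n + 1) ω) ∂μ := by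
        rw [← integral_add_compl (hpos (n + 1)) (hint _)]
        congr 3
        ext ω
        simp
      rw [← mul_add, ← hun, complexMGF_map_walk hmeas hindep hident]
      push_cast
      rw [mul_pow]
      ring
    have h5 : Complex.exp (-(A s + B s)) = 1 - z * φ := by
      have := Complex.hasSum_taylorSeries_neg_log hφ1
      rw [← hasSum_nat_add_iff' 1] at this
      simp only [Finset.sum_range_one, pow_zero, Nat.cast_zero, div_zero, sub_zero, Nat.cast_add,
        Nat.cast_one] at this
      rw [h4.unique this, neg_neg, Complex.exp_log]
      intro h
      rw [sub_eq_zero] at h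
      rw [← h] at hφ1
      simp at hφ1
    have h6 : 1 - Q s = (1 + P s) * Complex.exp (-(A s + B s)) := by
      rw [h5]
      linear_combination -h3
    rw [h6, mul_assoc, ← Complex.exp_add]
    congr 3
    ring
  have hF : IsTransform (Set.Ioi 0) {s : ℂ | s.re ≤ 0}
      (fun s => (1 - Q s) * Complex.exp (A s) - 1) := by
    have hE := transformDomain_Ioi.exp_sub_one hA
    refine (transformDomain_Ioi.add (transformDomain_Ioi.add hE hQ.neg)
      (transformDomain_Ioi.mul hQ hE).neg).congr fun s _ => ?_
    ring
  have hG : IsTransform (Set.Iic 0) {s : ℂ | s.re = 0}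
      (fun s => (1 + P s) * Complex.exp (-B s) - 1) := by
    have hE := transformDomain_Iic.exp_sub_one hB.neg
    refine (transformDomain_Iic.add (transformDomain_Iic.add hE hP)
      (transformDomain_Iic.mul hP hE)).congr fun s _ => ?_
    ring
  have hrs : (((-r : ℝ) : ℂ)).re ≤ 0 := by simpa using hr
  have hfinal := hF.eq_zero_of_eq hG haxis hrs
  have hQr := hQs _ hrs
  have hAr := hAs _ hrs
  simp only [complexMGF_map_restrict_neg hmeas, ← Complex.ofReal_mul] at hQr hAr
  apply Complex.ofReal_injective
  rw [Complex.ofReal_sub, Complex.ofReal_one, Complex.ofReal_exp, Complex.ofReal_neg,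
    Complex.ofReal_tsum, Complex.ofReal_tsum, hQr.tsum_eq, hAr.tsum_eq, Complex.exp_neg]
  exact eq_inv_of_mul_eq_one_left (sub_eq_zero.1 hfinal)

end Walk

/-! ### The Poisson kernel of the half-plane -/

/-- The Poisson kernel `r / (π (r² + t²))` of the half-plane, which is the density of the Cauchy
law of scale `r`. -/
noncomputable def poissonKer (r t : ℝ) : ℝ := Real.pi⁻¹ * (r / (r ^ 2 + t ^ 2))

section Poisson

variable {r : ℝ}

lemma poissonKer_nonneg (hr : 0 < r) (t : ℝ) : 0 ≤ poissonKer r t := by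
  unfold poissonKer
  positivity

lemma poissonKer_pos (hr : 0 < r) (t : ℝ) : 0 < poissonKer r t := by
  unfold poissonKer
  positivity

lemma poissonKer_eq (hr : 0 < r) (t : ℝ) :
    poissonKer r t = (Real.pi⁻¹ * r⁻¹) * (1 + (t / r) ^ 2)⁻¹ := by
  unfold poissonKer
  field_simp

lemma continuous_poissonKer (hr : 0 < r) : Continuous (poissonKer r) := by
  unfold poissonKer
  refine continuous_const.mul (Continuous.div (by fun_prop) (by fun_prop) fun t => ?_)
  positivity

lemma integrable_poissonKer (hr : 0 < r) : Integrable (poissonKer r) := by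
  rw [funext (poissonKer_eq hr)]
  exact (integrable_inv_one_add_sq.comp_div hr.ne').const_mul _

lemma integral_poissonKer (hr : 0 < r) : ∫ t, poissonKer r t = 1 := by
  rw [funext (poissonKer_eq hr), integral_const_mul,
    Measure.integral_comp_div (fun t : ℝ => (1 + t ^ 2)⁻¹), integral_univ_inv_one_add_sq,
    abs_of_pos hr, smul_eq_mul]
  have := Real.pi_pos
  field_simp

lemma integral_exp_neg_abs_mul_exp (hr : 0 < r) (w : ℝ) :
    Integrable (fun x : ℝ => Complex.exp (w * x * Complex.I) * Complex.exp (-r * |x|)) ∧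
      ∫ x : ℝ, Complex.exp (w * x * Complex.I) * Complex.exp (-r * |x|) =
        ((2 * r / (r ^ 2 + w ^ 2) : ℝ) : ℂ) := by
  have h1 : Set.EqOn
      (fun x : ℝ => Complex.exp (w * x * Complex.I) * Complex.exp (-r * |x|))
      (fun x : ℝ => Complex.exp ((r + w * Complex.I) * x)) (Set.Iic 0) := by
    intro x hx
    simp only
    rw [abs_of_nonpos hx, ← Complex.exp_add]
    congr 1
    push_cast
    ring
  have h2 : Set.EqOn
      (fun x : ℝ => Complex.exp (w * x * Complex.I) * Complex.exp (-r * |x|))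
      (fun x : ℝ => Complex.exp ((-r + w * Complex.I) * x)) (Set.Ioi 0) := by
    intro x hx
    simp only
    rw [abs_of_pos hx, ← Complex.exp_add]
    congr 1
    ring
  have hre1 : 0 < ((r : ℂ) + w * Complex.I).re := by simpa using hr
  have hre2 : (-(r : ℂ) + w * Complex.I).re < 0 := by simpa using hr
  have i1 := (integrableOn_exp_mul_complex_Iic hre1 0).congr_fun h1.symm measurableSet_Iic
  have i2 := (integrableOn_exp_mul_complex_Ioi hre2 0).congr_fun h2.symm measurableSet_Ioi
  have hi : Integrable
      (fun x : ℝ => Complex.exp (w * x * Complex.I) * Complex.exp (-r * |x|)) := by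
    rw [← integrableOn_univ, ← Set.Iic_union_Ioi (a := (0 : ℝ))]
    exact i1.union i2
  refine ⟨hi, ?_⟩
  rw [← intervalIntegral.integral_Iic_add_Ioi i1 i2, setIntegral_congr_fun measurableSet_Iic h1,
    setIntegral_congr_fun measurableSet_Ioi h2, integral_exp_mul_complex_Iic hre1,
    integral_exp_mul_complex_Ioi hre2]
  have e1 : (r : ℂ) + w * Complex.I ≠ 0 := fun h => by rw [h] at hre1; simp at hre1
  have e2 : -(r : ℂ) + w * Complex.I ≠ 0 := fun h => by rw [h] at hre2; simp at hre2
  have e3 : (r : ℂ) ^ 2 + w ^ 2 ≠ 0 := by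
    have : (r ^ 2 + w ^ 2 : ℝ) ≠ 0 := by positivity
    exact_mod_cast this
  push_cast
  simp only [mul_zero, Complex.exp_zero]
  field_simp
  ring_nf
  simp only [Complex.I_sq]
  ring

/-- The characteristic function of the Cauchy law, by Fourier inversion of `exp (-r |x|)`. -/
lemma integral_poissonKer_mul_exp (hr : 0 < r) (x : ℝ) :
    ∫ t : ℝ, (poissonKer r t : ℂ) * Complex.exp (t * x * Complex.I) =
      ((Real.exp (-r * |x|) : ℝ) : ℂ) := by
  set f : ℝ → ℂ := fun x => Complex.exp (-r * |x|) with hf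
  have hcont : Continuous f := by fun_prop
  have hfi : Integrable f := by simpa [hf] using (integral_exp_neg_abs_mul_exp hr 0).1
  have hF : FourierTransform.fourier f =
      fun w => (((2 * Real.pi) * poissonKer r (2 * Real.pi * w) : ℝ) : ℂ) := by
    ext w
    rw [Real.fourier_real_eq_integral_exp_smul]
    have := (integral_exp_neg_abs_mul_exp hr (-(2 * Real.pi * w))).2
    convert this using 1
    · congr 1 with x
      rw [smul_eq_mul]
      congr 2
      push_cast
      ring
    · congr 1
      unfold poissonKer
      have := Real.pi_pos
      field_simp
  have hFi : Integrable (FourierTransform.fourier f) := by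
    rw [hF]
    have := (integrable_poissonKer hr).comp_mul_left' (R := 2 * Real.pi) (by positivity)
    exact (this.const_mul _).ofReal
  have hinv := hfi.fourierInv_fourier_eq hFi (v := x) hcont.continuousAt
  rw [Real.fourierInv_eq', hF] at hinv
  have hsub := Measure.integral_comp_mul_left
    (fun t : ℝ => (poissonKer r t : ℂ) * Complex.exp (t * x * Complex.I)) (2 * Real.pi)
  have hpi : (0 : ℝ) < (2 * Real.pi)⁻¹ := by positivity
  rw [abs_of_pos hpi] at hsub
  have : ((Real.exp (-r * |x|) : ℝ) : ℂ) = f x := by simp [hf]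
  rw [this, ← hinv]
  have h3 : ∫ t : ℝ, (poissonKer r t : ℂ) * Complex.exp (t * x * Complex.I) =
      ((2 * Real.pi : ℝ) : ℂ) * (((2 * Real.pi)⁻¹ : ℝ) •
        ∫ t : ℝ, (poissonKer r t : ℂ) * Complex.exp (t * x * Complex.I)) := by
    rw [Complex.real_smul, ← mul_assoc, ← Complex.ofReal_mul,
      mul_inv_cancel₀ (by positivity), Complex.ofReal_one, one_mul]
  rw [h3, ← hsub, ← integral_const_mul]
  congr 1 with v
  simp only [smul_eq_mul, RCLike.inner_apply, conj_trivial]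
  push_cast
  ring_nf

/-- `E exp (-r |X|)` is the Poisson integral of the characteristic function of `X`. -/
lemma integral_exp_neg_abs_eq_poisson (hr : 0 < r) (m : Measure ℝ) [IsProbabilityMeasure m] :
    ∫ x, Real.exp (-r * |x|) ∂m = ∫ t, poissonKer r t * (charFun m t).re := by
  have hcont := continuous_poissonKer hr
  have hint : Integrable (Function.uncurry fun (x t : ℝ) =>
      (poissonKer r t : ℂ) * Complex.exp (t * x * Complex.I)) (m.prod volume) := by
    have h0 : Integrable (fun p : ℝ × ℝ => poissonKer r p.2) (m.prod volume) :=
      (integrable_poissonKer hr).comp_snd m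
    refine h0.mono' (by unfold Function.uncurry; fun_prop) (ae_of_all _ fun p => ?_)
    simp only [Function.uncurry]
    rw [norm_mul, ← Complex.ofReal_mul, Complex.norm_exp_ofReal_mul_I, mul_one,
      Complex.norm_real, Real.norm_of_nonneg (poissonKer_nonneg hr _)]
  have hswap := integral_integral_swap hint
  simp_rw [integral_poissonKer_mul_exp hr, integral_const_mul] at hswap
  rw [integral_complex_ofReal] at hswap
  have h2 : ∀ t : ℝ, ∫ x : ℝ, Complex.exp (t * x * Complex.I) ∂m = charFun m t := fun t => by
    rw [charFun_apply_real]
  simp_rw [h2] at hswap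
  have h3 : Integrable fun t : ℝ => (poissonKer r t : ℂ) * charFun m t := by
    refine (integrable_poissonKer hr).mono'
      ((Complex.continuous_ofReal.comp hcont).aestronglyMeasurable.mul
        measurable_charFun.aestronglyMeasurable) (ae_of_all _ fun t => ?_)
    rw [norm_mul, Complex.norm_real, Real.norm_of_nonneg (poissonKer_nonneg hr _)]
    exact mul_le_of_le_one_right (poissonKer_nonneg hr _) (norm_charFun_le_one t)
  have h4 := congrArg Complex.re hswap
  rw [Complex.ofReal_re] at h4
  rw [h4, ← RCLike.re_to_complex, ← integral_re h3]
  simp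

lemma abs_log_one_sub_mul_le {z y : ℝ} (hz0 : 0 < z) (hz1 : z < 1) (hy : |y| ≤ 1) :
    |Real.log (1 - z * y)| ≤ -Real.log (1 - z) + Real.log 2 := by
  have h1 := abs_le.1 hy
  have h2 : 1 - z ≤ 1 - z * y := by nlinarith
  have h3 : 1 - z * y ≤ 2 := by nlinarith
  have h4 : Real.log (1 - z) ≤ 0 := Real.log_nonpos (by linarith) (by linarith)
  have h5 : 0 ≤ Real.log 2 := Real.log_nonneg (by norm_num)
  have h6 := Real.log_le_log (by linarith) h2
  have h7 := Real.log_le_log (by linarith) h3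
  rw [abs_le]
  constructor <;> linarith

/-- Term by term integration of the logarithmic series of a function bounded by `1`. -/
lemma hasSum_integral_pow_div {α : Type*} [MeasurableSpace α] {κ : Measure α} {k φ : α → ℝ}
    (hk0 : ∀ t, 0 ≤ k t) (hk : Integrable k κ) (hφm : AEStronglyMeasurable φ κ)
    (hφ : ∀ t, |φ t| ≤ 1) {z : ℝ} (hz0 : 0 < z) (hz1 : z < 1) :
    HasSum (fun n : ℕ => z ^ (n + 1) / (n + 1) * ∫ t, k t * φ t ^ (n + 1) ∂κ)
      (∫ t, k t * -Real.log (1 - z * φ t) ∂κ) := by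
  have hint : ∀ n : ℕ, Integrable (fun t => k t * φ t ^ (n + 1)) κ := by
    intro n
    refine hk.mono' (hk.aestronglyMeasurable.mul (hφm.pow _)) (ae_of_all _ fun t => ?_)
    rw [norm_mul, Real.norm_of_nonneg (hk0 t), norm_pow]
    exact mul_le_of_le_one_right (hk0 t) (pow_le_one₀ (norm_nonneg _) (hφ t))
  have hsum : Summable fun n : ℕ =>
      ∫ t, ‖z ^ (n + 1) / (n + 1) * (k t * φ t ^ (n + 1))‖ ∂κ := by
    refine Summable.of_nonneg_of_le (fun n => integral_nonneg fun t => norm_nonneg _)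
      (g := fun n : ℕ => ∫ t, ‖z ^ (n + 1) / (n + 1) * (k t * φ t ^ (n + 1))‖ ∂κ)
      (f := fun n : ℕ => z ^ (n + 1) * ∫ t, k t ∂κ) (fun n => ?_)
      (((summable_nat_add_iff 1).2 (summable_geometric_of_lt_one hz0.le hz1)).mul_right _)
    rw [← integral_const_mul]
    refine integral_mono ((hint n).const_mul _).norm (hk.const_mul _) fun t => ?_
    simp only
    rw [norm_mul, norm_mul, Real.norm_of_nonneg (hk0 t), norm_pow]
    refine mul_le_mul (abs_pow_div_le hz0 n)
      (mul_le_of_le_one_right (hk0 t) (pow_le_one₀ (norm_nonneg _) (hφ t)))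
      (mul_nonneg (hk0 t) (pow_nonneg (norm_nonneg _) _)) (by positivity)
  have := hasSum_integral_of_summable_integral_norm (fun n => (hint n).const_mul _) hsum
  simp_rw [integral_const_mul] at this
  have hlog : ∀ t, k t * -Real.log (1 - z * φ t) =
      ∑' n : ℕ, z ^ (n + 1) / (n + 1) * (k t * φ t ^ (n + 1)) := by
    intro t
    have h1 : |z * φ t| < 1 := by
      rw [abs_mul, abs_of_pos hz0]
      exact (mul_le_of_le_one_right hz0.le (hφ t)).trans_lt hz1
    have h2 := (Real.hasSum_pow_div_log_of_abs_lt_one h1).mul_left (k t)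
    rw [← h2.tsum_eq]
    congr 1 with n
    rw [mul_pow]
    ring
  simp_rw [hlog]
  exact this

end Poisson

/-! ### Integrals of the logarithmic series at the boundary of the disc -/

section Abel

/-- Abel's theorem for a summable sequence, with the powers shifted by one. -/
lemma tendsto_tsum_pow_mul {a : ℕ → ℝ} (ha : Summable a) (h0 : ∀ n, 0 ≤ a n) :
    Tendsto (fun z : ℝ => ∑' n : ℕ, z ^ (n + 1) * a n) (𝓝[<] 1) (𝓝 (∑' n, a n)) := by
  refine tendsto_tsum_of_dominated_convergence ha (fun n => ?_) ?_
  · have : Tendsto (fun z : ℝ => z ^ (n + 1) * a n) (𝓝 1) (𝓝 (1 ^ (n + 1) * a n)) :=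
      ((continuous_pow (n + 1)).mul continuous_const).tendsto 1
    rw [one_pow, one_mul] at this
    exact this.mono_left nhdsWithin_le_nhds
  · filter_upwards [Ioo_mem_nhdsLT (show (0 : ℝ) < 1 by norm_num)] with z hz n
    rw [norm_mul, norm_pow, Real.norm_of_nonneg hz.1.le, Real.norm_of_nonneg (h0 n)]
    exact mul_le_of_le_one_left (h0 n) (pow_le_one₀ hz.1.le hz.2.le)

/-- Integration of `-log (1 - φ) = ∑ φ ^ n / n` against a kernel `k`, when the integrated series
has nonnegative summable terms. Only an upper bound of the integrals of `-log (1 - z φ)` with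
`z < 1` is at hand, so that integrability comes from Fatou's lemma. -/
lemma integrable_log_one_sub_and_tsum {α : Type*} [MeasurableSpace α] {κ : Measure α}
    {k φ : α → ℝ} (hk0 : ∀ t, 0 < k t) (hkm : Measurable k) (hk : Integrable k κ)
    (hφm : Measurable φ) (hφ : ∀ t, |φ t| ≤ 1) {a : ℕ → ℝ}
    (ha : ∀ n, a n = ∫ t, k t * φ t ^ (n + 1) ∂κ) (ha0 : ∀ n, 0 ≤ a n)
    (hsum : Summable fun n : ℕ => a n / (n + 1)) :
    Integrable (fun t => k t * Real.log (1 - φ t)) κ ∧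
      ∑' n : ℕ, a n / (n + 1) = -∫ t, k t * Real.log (1 - φ t) ∂κ := by
  have h0 : ∀ n : ℕ, 0 ≤ a n / (n + 1) := fun n => div_nonneg (ha0 n) (by positivity)
  have hser : ∀ z : ℝ, 0 < z → z < 1 → ∑' n : ℕ, z ^ (n + 1) * (a n / (n + 1)) =
      ∫ t, k t * -Real.log (1 - z * φ t) ∂κ := by
    intro z hz0 hz1
    rw [← (hasSum_integral_pow_div (fun t => (hk0 t).le) hk hφm.aestronglyMeasurable hφ hz0
      hz1).tsum_eq]
    congr 1 with n
    rw [ha]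
    ring
  have hlogm : ∀ z : ℝ, Measurable fun t => Real.log (1 - z * φ t) := fun z => by fun_prop
  -- upper bound at every point, and a bound uniform in `z` off the set `φ = 1`
  have hlog2 : ∀ z y : ℝ, 0 < z → z ≤ 1 → |y| ≤ 1 → Real.log (1 - z * y) ≤ Real.log 2 := by
    intro z y hz0 hz1 hy
    have hy' := abs_le.1 hy
    rcases eq_or_lt_of_le (show 0 ≤ 1 - z * y by nlinarith) with h | h
    · rw [← h, Real.log_zero]
      exact Real.log_nonneg (by norm_num)
    · exact Real.log_le_log h (by nlinarith)
  have hdom : ∀ z y : ℝ, 0 < z → z < 1 → |y| ≤ 1 → y ≠ 1 →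
      |Real.log (1 - z * y)| ≤ |Real.log (1 - y)| + Real.log 2 := by
    intro z y hz0 hz1 hy hy1
    have hy' := abs_le.1 hy
    have hlt : 0 < 1 - y := by
      rcases lt_or_eq_of_le hy'.2 with h | h
      · linarith
      · exact absurd h hy1
    have h2 := hlog2 z y hz0 hz1.le hy
    have h3 : (0 : ℝ) ≤ Real.log 2 := Real.log_nonneg (by norm_num)
    have h4 := neg_abs_le (Real.log (1 - y))
    rcases le_or_gt 0 y with h | h
    · have := Real.log_le_log hlt (show 1 - y ≤ 1 - z * y by nlinarith)
      rw [abs_le]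
      constructor <;> linarith [abs_nonneg (Real.log (1 - y))]
    · have := Real.log_nonneg (show 1 ≤ 1 - z * y by nlinarith)
      rw [abs_of_nonneg this]
      linarith [abs_nonneg (Real.log (1 - y))]
  have hl2 : (0 : ℝ) ≤ Real.log 2 := Real.log_nonneg (by norm_num)
  -- a sequence increasing to one
  set w : ℕ → ℝ := fun j => 1 - 1 / ((j : ℝ) + 2) with hw
  have hw0 : ∀ j, 0 < w j := by
    intro j
    have : (1 : ℝ) / ((j : ℝ) + 2) ≤ 1 / 2 :=
      one_div_le_one_div_of_le (by norm_num) (by linarith [Nat.cast_nonneg (α := ℝ) j])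
    simp only [hw]
    linarith
  have hw1 : ∀ j, w j < 1 := by
    intro j
    have : (0 : ℝ) < 1 / ((j : ℝ) + 2) := by positivity
    simp only [hw]
    linarith
  have hwt : Tendsto w atTop (𝓝 1) := by
    have h1 : Tendsto (fun j : ℕ => (1 : ℝ) / ((j : ℝ) + 2)) atTop (𝓝 0) := by
      have := (tendsto_one_div_add_atTop_nhds_zero_nat (𝕜 := ℝ)).comp (tendsto_add_atTop_nat 1)
      refine this.congr fun j => ?_
      simp only [Function.comp]
      push_cast
      ring
    have h2 := h1.const_sub 1
    rwa [sub_zero] at h2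
  have hwt' : Tendsto w atTop (𝓝[<] 1) :=
    tendsto_nhdsWithin_iff.2 ⟨hwt, Eventually.of_forall hw1⟩
  -- Fatou's lemma for `k (log 2 - log (1 - w j φ))`, which is nonnegative by the upper bound
  set f : ℕ → α → ℝ := fun j t => k t * (Real.log 2 - Real.log (1 - w j * φ t)) with hf
  have hf0 : ∀ j t, 0 ≤ f j t := fun j t =>
    mul_nonneg (hk0 t).le (sub_nonneg.2 (hlog2 _ _ (hw0 j) (hw1 j).le (hφ t)))
  have hfm : ∀ j, Measurable (f j) := fun j =>
    hkm.mul (measurable_const.sub (hlogm (w j)))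
  have hlogint : ∀ z : ℝ, 0 < z → z < 1 →
      Integrable (fun t => k t * -Real.log (1 - z * φ t)) κ := by
    intro z hz0 hz1
    refine (hk.mul_const (-Real.log (1 - z) + Real.log 2)).mono'
      (hkm.mul (hlogm z).neg).aestronglyMeasurable (ae_of_all _ fun t => ?_)
    rw [norm_mul, Real.norm_of_nonneg (hk0 t).le, norm_neg]
    exact mul_le_mul_of_nonneg_left (abs_log_one_sub_mul_le hz0 hz1 (hφ t)) (hk0 t).le
  set C : ℝ := Real.log 2 * (∫ t, k t ∂κ) + ∑' n : ℕ, a n / (n + 1) with hC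
  have hfint : ∀ j, ∫⁻ t, ENNReal.ofReal (f j t) ∂κ ≤ ENNReal.ofReal C := by
    intro j
    have hi : f j = fun t => Real.log 2 * k t + k t * -Real.log (1 - w j * φ t) := by
      ext t
      simp only [hf]
      ring
    have hii : Integrable (f j) κ := by
      rw [hi]
      exact (hk.const_mul _).add (hlogint _ (hw0 j) (hw1 j))
    rw [← ofReal_integral_eq_lintegral_ofReal hii (ae_of_all _ (hf0 j))]
    refine ENNReal.ofReal_le_ofReal ?_
    rw [hi, integral_add (hk.const_mul _) (hlogint _ (hw0 j) (hw1 j)), integral_const_mul, hC,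
      ← hser _ (hw0 j) (hw1 j)]
    have hle : ∀ n : ℕ, w j ^ (n + 1) * (a n / (n + 1)) ≤ a n / (n + 1) := fun n =>
      mul_le_of_le_one_left (h0 n) (pow_le_one₀ (hw0 j).le (hw1 j).le)
    have := (Summable.of_nonneg_of_le
      (fun n => mul_nonneg (pow_nonneg (hw0 j).le _) (h0 n)) hle hsum).tsum_le_tsum hle hsum
    linarith
  have hfatou : ∫⁻ t, liminf (fun j => ENNReal.ofReal (f j t)) atTop ∂κ ≤ ENNReal.ofReal C :=
    (lintegral_liminf_le fun j => (hfm j).ennreal_ofReal).trans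
      (liminf_le_of_le (by isBoundedDefault) fun b hb => by
        obtain ⟨j, hj⟩ := hb.exists
        exact hj.trans (hfint j))
  -- where `φ = 1` the functions `f j` tend to infinity, although `Real.log (1 - φ) = 0` there
  have hae : ∀ᵐ t ∂κ, φ t ≠ 1 := by
    have hlt := ae_lt_top' (Measurable.liminf fun j => (hfm j).ennreal_ofReal).aemeasurable
      (hfatou.trans_lt ENNReal.ofReal_lt_top).ne
    filter_upwards [hlt] with t ht h1
    refine ht.ne ?_
    have : Tendsto (fun j => ENNReal.ofReal (f j t)) atTop (𝓝 ⊤) := by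
      refine ENNReal.tendsto_ofReal_nhds_top.2 ?_
      simp only [hf, h1, mul_one]
      refine Tendsto.const_mul_atTop (hk0 t) ?_
      have h2 : Tendsto (fun j => 1 - w j) atTop (𝓝[>] 0) := by
        refine tendsto_nhdsWithin_iff.2 ⟨by simpa using hwt.const_sub 1,
          Eventually.of_forall fun j => ?_⟩
        simpa using hw1 j
      have h3 := Real.tendsto_log_nhdsGT_zero.comp h2
      exact tendsto_atTop_add_const_left _ _ (tendsto_neg_atBot_atTop.comp h3)
    exact this.liminf_eq
  have hlim : ∀ t, φ t ≠ 1 → ∀ v : ℕ → ℝ, Tendsto v atTop (𝓝 1) →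
      Tendsto (fun j => Real.log (1 - v j * φ t)) atTop (𝓝 (Real.log (1 - φ t))) := by
    intro t ht v hv
    have h1 : Tendsto (fun j => 1 - v j * φ t) atTop (𝓝 (1 - φ t)) := by
      simpa using (hv.mul_const (φ t)).const_sub 1
    exact h1.log (sub_ne_zero.2 (Ne.symm ht))
  have hint2 : Integrable (fun t => k t * (Real.log 2 - Real.log (1 - φ t))) κ := by
    refine ⟨(hkm.mul (measurable_const.sub
      (Real.measurable_log.comp (measurable_const.sub hφm)))).aestronglyMeasurable, ?_⟩
    rw [hasFiniteIntegral_iff_ofReal (ae_of_all _ fun t => mul_nonneg (hk0 t).le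
      (sub_nonneg.2 (by simpa using hlog2 1 _ one_pos le_rfl (hφ t))))]
    refine lt_of_le_of_lt (lintegral_mono_ae ?_) (hfatou.trans_lt ENNReal.ofReal_lt_top)
    filter_upwards [hae] with t ht
    have : Tendsto (fun j => ENNReal.ofReal (f j t)) atTop
        (𝓝 (ENNReal.ofReal (k t * (Real.log 2 - Real.log (1 - φ t))))) :=
      ENNReal.tendsto_ofReal (((hlim t ht w hwt).const_sub _).const_mul _)
    rw [this.liminf_eq]
  have hint : Integrable (fun t => k t * Real.log (1 - φ t)) κ := by
    have := (hk.mul_const (Real.log 2)).sub hint2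
    refine this.congr (ae_of_all _ fun t => ?_)
    simp only [Pi.sub_apply]
    ring
  refine ⟨hint, ?_⟩
  have hL : Tendsto (fun j => ∫ t, k t * -Real.log (1 - w j * φ t) ∂κ) atTop
      (𝓝 (∫ t, k t * -Real.log (1 - φ t) ∂κ)) := by
    refine tendsto_integral_of_dominated_convergence
      (fun t => |k t * Real.log (1 - φ t)| + k t * Real.log 2)
      (fun j => (hlogint _ (hw0 j) (hw1 j)).aestronglyMeasurable)
      (hint.abs.add (hk.mul_const _)) (fun j => ?_) ?_
    · filter_upwards [hae] with t ht
      rw [norm_mul, norm_neg, Real.norm_of_nonneg (hk0 t).le, abs_mul, abs_of_pos (hk0 t), ← mul_add]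
      exact mul_le_mul_of_nonneg_left (hdom _ _ (hw0 j) (hw1 j) (hφ t) ht) (hk0 t).le
    · filter_upwards [hae] with t ht
      exact ((hlim t ht w hwt).neg).const_mul _
  have hR := (tendsto_tsum_pow_mul hsum h0).comp hwt'
  rw [← integral_neg]
  simp_rw [← mul_neg]
  refine tendsto_nhds_unique hR (hL.congr fun j => ?_)
  exact (hser _ (hw0 j) (hw1 j)).symm

end Abel

/-! ### The Laplace transform of the first-ladder height -/

section LadderHeight

variable {Ω : Type*} {mΩ : MeasurableSpace Ω} {μ : Measure Ω} {ξ : ℕ → Ω → ℝ}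

/-- The event `𝒯 < ∞`. -/
def ladderExists (ξ : ℕ → Ω → ℝ) : Set Ω := {ω | ∃ n : ℕ, 0 < n ∧ 0 < walk ξ n ω}

lemma ladderTime_eq_of_mem {n : ℕ} {ω : Ω} (h : ω ∈ ladderEvent ξ n) :
    ladderTime ξ ω = n + 1 := by
  refine le_antisymm (Nat.sInf_le ⟨n.succ_pos, h.2⟩) ?_
  by_contra! hlt
  have hmem := Nat.sInf_mem (s := {k : ℕ | 0 < k ∧ 0 < walk ξ k ω}) ⟨n + 1, n.succ_pos, h.2⟩
  exact absurd hmem.2 (not_lt.2 (h.1 _ (Nat.lt_succ_iff.1 hlt)))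

lemma ladderExists_eq_iUnion : ladderExists ξ = ⋃ n, ladderEvent ξ n := by
  ext ω
  simp only [ladderExists, Set.mem_ofPred_eq, Set.mem_iUnion]
  constructor
  · intro h
    obtain ⟨h1, h2⟩ := Nat.sInf_mem (s := {k : ℕ | 0 < k ∧ 0 < walk ξ k ω}) h
    obtain ⟨n, hn⟩ := Nat.exists_eq_succ_of_ne_zero h1.ne'
    refine ⟨n, fun k hk => ?_, by rw [hn] at h2; exact h2⟩
    by_contra! hlt
    rcases Nat.eq_zero_or_pos k with rfl | hk0
    · simp [walk] at hlt
    · have := Nat.sInf_le (s := {k : ℕ | 0 < k ∧ 0 < walk ξ k ω}) ⟨hk0, hlt⟩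
      omega
  · rintro ⟨n, hn⟩
    exact ⟨n + 1, n.succ_pos, hn.2⟩

lemma pairwise_disjoint_ladderEvent : Pairwise (Function.onFun Disjoint (ladderEvent ξ)) := by
  intro i j hij
  rw [Function.onFun, Set.disjoint_left]
  intro ω hi hj
  have := (ladderTime_eq_of_mem hi).symm.trans (ladderTime_eq_of_mem hj)
  omega

lemma measurableSet_ladderExists (hmeas : ∀ k, Measurable (ξ k)) :
    MeasurableSet (ladderExists ξ) := by
  rw [ladderExists_eq_iUnion]
  exact MeasurableSet.iUnion fun n => measurableSet_ladderEvent hmeas n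

lemma ladderTime_eq_zero_of_notMem {ω : Ω} (h : ω ∉ ladderExists ξ) : ladderTime ξ ω = 0 := by
  have : {n : ℕ | 0 < n ∧ 0 < walk ξ n ω} = ∅ := by
    ext n
    simp only [Set.mem_ofPred_eq, Set.mem_empty_iff_false, iff_false]
    exact fun hn => h ⟨n, hn⟩
  rw [ladderTime, this, Nat.sInf_empty]

lemma leapover_eq_of_mem {n : ℕ} {ω : Ω} (h : ω ∈ ladderEvent ξ n) :
    leapover ξ ω = walk ξ (n + 1) ω := by
  rw [leapover, ladderTime_eq_of_mem h]

lemma leapover_pos {ω : Ω} (h : ω ∈ ladderExists ξ) : 0 < leapover ξ ω := by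
  rw [ladderExists_eq_iUnion, Set.mem_iUnion] at h
  obtain ⟨n, hn⟩ := h
  rw [leapover_eq_of_mem hn]
  exact hn.2

lemma leapover_nonneg (ω : Ω) : 0 ≤ leapover ξ ω := by
  by_cases h : ω ∈ ladderExists ξ
  · exact (leapover_pos h).le
  · rw [leapover, ladderTime_eq_zero_of_notMem h]
    simp [walk]

lemma measurable_leapover (hmeas : ∀ k, Measurable (ξ k)) : Measurable (leapover ξ) := by
  have hT : Measurable (ladderTime ξ) := by
    refine measurable_to_countable' fun n => ?_
    have : ladderTime ξ ⁻¹' {n} =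
        (if n = 0 then (ladderExists ξ)ᶜ else ladderEvent ξ (n - 1)) := by
      ext ω
      rw [Set.mem_preimage, Set.mem_singleton_iff]
      by_cases h : ω ∈ ladderExists ξ
      · have h' := h
        rw [ladderExists_eq_iUnion, Set.mem_iUnion] at h'
        obtain ⟨k, hk⟩ := h'
        rw [ladderTime_eq_of_mem hk]
        split_ifs with hn
        · simp [hn, h]
        · constructor
          · rintro rfl
            exact hk
          · intro hn'
            have := (ladderTime_eq_of_mem hk).symm.trans (ladderTime_eq_of_mem hn')
            omega
      · rw [ladderTime_eq_zero_of_notMem h]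
        split_ifs with hn
        · simp [hn, h]
        · constructor
          · intro h0
            exact absurd h0.symm hn
          · intro hn'
            exact absurd (by rw [ladderExists_eq_iUnion]; exact Set.mem_iUnion_of_mem _ hn') h
    rw [this]
    split_ifs
    · exact (measurableSet_ladderExists hmeas).compl
    · exact measurableSet_ladderEvent hmeas _
  have h2 : Measurable fun p : ℕ × Ω => walk ξ p.1 p.2 :=
    measurable_from_prod_countable_right fun n => measurable_walk hmeas n
  exact h2.comp (hT.prodMk measurable_id)

variable [IsProbabilityMeasure μ]

lemma integrable_exp_neg_mul {f : Ω → ℝ} (hf : Measurable f) {r : ℝ} (hr : 0 ≤ r) {E : Set Ω}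
    (hE : MeasurableSet E) (h0 : ∀ ω ∈ E, 0 ≤ f ω) :
    IntegrableOn (fun ω => Real.exp (-r * f ω)) E μ := by
  refine Integrable.of_bound (by fun_prop) 1 ?_
  filter_upwards [ae_restrict_mem hE] with ω hω
  rw [Real.norm_eq_abs, Real.abs_exp, Real.exp_le_one_iff]
  nlinarith [h0 ω hω]

lemma hasSum_ladderEvent (hmeas : ∀ k, Measurable (ξ k)) {r : ℝ} (hr : 0 ≤ r) :
    HasSum (fun n => ∫ ω in ladderEvent ξ n, Real.exp (-r * walk ξ (n + 1) ω) ∂μ)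
      (∫ ω in ladderExists ξ, Real.exp (-r * leapover ξ ω) ∂μ) := by
  have hi := integrable_exp_neg_mul (μ := μ) (measurable_leapover hmeas) hr
    (measurableSet_ladderExists hmeas) fun ω _ => leapover_nonneg ω
  rw [ladderExists_eq_iUnion] at hi ⊢
  refine (hasSum_integral_iUnion (fun n => measurableSet_ladderEvent hmeas n)
    pairwise_disjoint_ladderEvent hi).congr_fun fun n => ?_
  refine setIntegral_congr_fun (measurableSet_ladderEvent hmeas n) fun ω hω => ?_
  simp only [leapover_eq_of_mem hω]

lemma integral_ladderExists_lt_one (hmeas : ∀ k, Measurable (ξ k)) {r : ℝ} (hr : 0 < r) :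
    ∫ ω in ladderExists ξ, Real.exp (-r * leapover ξ ω) ∂μ < 1 := by
  have hi := integrable_exp_neg_mul (μ := μ) (measurable_leapover hmeas) hr.le
    (measurableSet_ladderExists hmeas) fun ω _ => leapover_nonneg ω
  rw [← integral_indicator (measurableSet_ladderExists hmeas)]
  have hi' := hi.integrable_indicator (measurableSet_ladderExists hmeas)
  have hlt : ∀ ω, (ladderExists ξ).indicator (fun ω => Real.exp (-r * leapover ξ ω)) ω < 1 := by
    intro ω
    by_cases h : ω ∈ ladderExists ξ
    · rw [Set.indicator_of_mem h, Real.exp_lt_one_iff]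
      nlinarith [leapover_pos h]
    · rw [Set.indicator_of_notMem h]
      exact one_pos
  have hpos : 0 < ∫ ω, (1 - (ladderExists ξ).indicator
      (fun ω => Real.exp (-r * leapover ξ ω)) ω) ∂μ := by
    rw [integral_pos_iff_support_of_nonneg (fun ω => (sub_pos.2 (hlt ω)).le)
      ((integrable_const 1).sub hi')]
    have : Function.support (fun ω => 1 - (ladderExists ξ).indicator
        (fun ω => Real.exp (-r * leapover ξ ω)) ω) = Set.univ := by
      ext ω
      simpa using (sub_pos.2 (hlt ω)).ne'
    rw [this]
    simp
  rw [integral_sub (integrable_const 1) hi'] at hpos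
  simpa using hpos

/-- The Spitzer–Baxter identity at `z = 1`. The series in the exponent converges because its Abel
sums are bounded by `-log (1 - 𝔼[exp (-r S_𝒯); 𝒯 < ∞])`, where the expectation is less than `1`. -/
lemma summable_and_one_sub_laplace_leapover (hmeas : ∀ k, Measurable (ξ k))
    (hindep : iIndepFun ξ μ) (hident : ∀ k, IdentDistrib (ξ k) (ξ 0) μ μ) {r : ℝ} (hr : 0 < r) :
    Summable (fun n : ℕ => (∫ ω in {ω | 0 < walk ξ (n + 1) ω},
        Real.exp (-r * walk ξ (n + 1) ω) ∂μ) / (n + 1)) ∧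
      1 - ∫ ω in ladderExists ξ, Real.exp (-r * leapover ξ ω) ∂μ =
        Real.exp (-∑' n : ℕ, (∫ ω in {ω | 0 < walk ξ (n + 1) ω},
          Real.exp (-r * walk ξ (n + 1) ω) ∂μ) / (n + 1)) := by
  set e : ℕ → ℝ := fun n => (∫ ω in {ω | 0 < walk ξ (n + 1) ω},
        Real.exp (-r * walk ξ (n + 1) ω) ∂μ) / (n + 1) with he
  set q : ℕ → ℝ := fun n => ∫ ω in ladderEvent ξ n, Real.exp (-r * walk ξ (n + 1) ω) ∂μ with hq
  set χ : ℝ := ∫ ω in ladderExists ξ, Real.exp (-r * leapover ξ ω) ∂μ with hχ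
  have hq0 : ∀ n, 0 ≤ q n := fun n => integral_nonneg fun ω => (Real.exp_pos _).le
  have he0 : ∀ n, 0 ≤ e n := fun n =>
    div_nonneg (integral_nonneg fun ω => (Real.exp_pos _).le) (by positivity)
  have hqs : HasSum q χ := hasSum_ladderEvent hmeas hr.le
  have hχ1 : χ < 1 := integral_ladderExists_lt_one hmeas hr
  have hwpos : ∀ n, MeasurableSet {ω | 0 < walk ξ n ω} := fun n =>
    measurableSet_lt measurable_const (measurable_walk hmeas n)
  have he1 : ∀ n : ℕ, e n ≤ 1 := by
    intro n
    have h1 : ∫ ω in {ω | 0 < walk ξ (n + 1) ω}, Real.exp (-r * walk ξ (n + 1) ω) ∂μ ≤ 1 := by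
      calc ∫ ω in {ω | 0 < walk ξ (n + 1) ω}, Real.exp (-r * walk ξ (n + 1) ω) ∂μ
          ≤ ∫ ω in {ω | 0 < walk ξ (n + 1) ω}, (1 : ℝ) ∂μ := by
            refine setIntegral_mono_on (integrable_exp_neg_mul (measurable_walk hmeas _) hr.le
              (hwpos _) fun ω hω => le_of_lt hω) (integrable_const _) (hwpos _) fun ω hω => ?_
            rw [Real.exp_le_one_iff]
            nlinarith [show 0 < walk ξ (n + 1) ω from hω]
        _ ≤ 1 := by simp
    calc e n ≤ (∫ ω in {ω | 0 < walk ξ (n + 1) ω}, Real.exp (-r * walk ξ (n + 1) ω) ∂μ) / 1 :=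
          div_le_div_of_nonneg_left (integral_nonneg fun ω => (Real.exp_pos _).le) one_pos
            (by linarith [Nat.cast_nonneg (α := ℝ) n])
      _ ≤ 1 := by rwa [div_one]
  have hident' : ∀ z : ℝ, 0 < z → z < 1 →
      1 - ∑' n : ℕ, z ^ (n + 1) * q n = Real.exp (-∑' n : ℕ, z ^ (n + 1) * e n) := by
    intro z hz0 hz1
    rw [spitzer_baxter hmeas hindep hident hz0 hz1 hr.le]
    congr 3 with n
    simp only [he]
    ring
  have hsz : ∀ z : ℝ, 0 < z → z < 1 → Summable fun n : ℕ => z ^ (n + 1) * e n := by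
    intro z hz0 hz1
    have := summable_of_le_geometric hz0 hz1 (c := fun n => z ^ (n + 1)) he0 he1
      fun n => (abs_of_nonneg (by positivity)).le
    refine this.congr fun n => ?_
    rw [abs_of_nonneg (by positivity)]
  have hbound : ∀ z : ℝ, 0 < z → z < 1 → ∑' n : ℕ, z ^ (n + 1) * e n ≤ -Real.log (1 - χ) := by
    intro z hz0 hz1
    have hle : ∀ n, z ^ (n + 1) * q n ≤ q n := fun n =>
      mul_le_of_le_one_left (hq0 n) (pow_le_one₀ hz0.le hz1.le)
    have h1 : ∑' n : ℕ, z ^ (n + 1) * q n ≤ χ := by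
      rw [← hqs.tsum_eq]
      exact (Summable.of_nonneg_of_le (fun n => mul_nonneg (by positivity) (hq0 n)) hle
        hqs.summable).tsum_le_tsum hle hqs.summable
    have h2 := Real.log_le_log (sub_pos.2 hχ1) (sub_le_sub_left h1 1)
    rw [hident' z hz0 hz1, Real.log_exp] at h2
    linarith
  have hsum : Summable e := by
    refine summable_of_sum_range_le he0 (c := -Real.log (1 - χ)) fun N => ?_
    have hcont : Tendsto (fun z : ℝ => ∑ n ∈ Finset.range N, z ^ (n + 1) * e n) (𝓝[<] 1)
        (𝓝 (∑ n ∈ Finset.range N, e n)) := by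
      have : Continuous fun z : ℝ => ∑ n ∈ Finset.range N, z ^ (n + 1) * e n := by fun_prop
      simpa using (this.tendsto 1).mono_left nhdsWithin_le_nhds
    refine le_of_tendsto hcont ?_
    filter_upwards [Ioo_mem_nhdsLT (show (0 : ℝ) < 1 by norm_num)] with z hz
    exact ((hsz z hz.1 hz.2).sum_le_tsum _ fun n _ =>
      mul_nonneg (pow_nonneg hz.1.le _) (he0 n)).trans (hbound z hz.1 hz.2)
  refine ⟨hsum, ?_⟩
  have hL := (tendsto_tsum_pow_mul hqs.summable hq0).const_sub 1
  have hR := (Real.continuous_exp.tendsto _).comp (tendsto_tsum_pow_mul hsum he0).neg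
  rw [hqs.tsum_eq] at hL
  refine tendsto_nhds_unique (hL.congr' ?_) hR
  filter_upwards [Ioo_mem_nhdsLT (show (0 : ℝ) < 1 by norm_num)] with z hz
  exact hident' z hz.1 hz.2

end LadderHeight

/-! ### Symmetric walks -/

section Symmetric

/-- For a symmetric law the integral of `exp (-r |x|)` splits into two equal halves and the
atom at `0`. -/
lemma integral_exp_neg_abs_of_symmetric (m : Measure ℝ) [IsProbabilityMeasure m]
    (hm : m.map (fun x => -x) = m) {r : ℝ} (hr : 0 < r) :
    2 * (∫ x in Set.Ioi 0, Real.exp (-r * x) ∂m) + m.real {0} = ∫ x, Real.exp (-r * |x|) ∂m := by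
  have hi : Integrable (fun x => Real.exp (-r * |x|)) m := by
    refine Integrable.of_bound (by fun_prop) 1 (ae_of_all _ fun x => ?_)
    rw [Real.norm_eq_abs, Real.abs_exp, Real.exp_le_one_iff]
    nlinarith [abs_nonneg x]
  have h1 : ∫ x in Set.Ioi 0, Real.exp (-r * |x|) ∂m = ∫ x in Set.Ioi 0, Real.exp (-r * x) ∂m :=
    setIntegral_congr_fun measurableSet_Ioi fun x hx => by
      simp only [abs_of_pos (Set.mem_Ioi.1 hx)]
  have h2 : ∫ x in Set.Iio 0, Real.exp (-r * |x|) ∂m = ∫ x in Set.Ioi 0, Real.exp (-r * x) ∂m := by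
    rw [← h1]
    conv_rhs => rw [← hm]
    rw [setIntegral_map measurableSet_Ioi (by fun_prop) (by fun_prop)]
    simp
  have h3 : ∫ x in {0}, Real.exp (-r * |x|) ∂m = m.real {0} := by simp [measureReal_def]
  have h4 : ∫ x in Set.Iic 0, Real.exp (-r * |x|) ∂m =
      (∫ x in Set.Iio 0, Real.exp (-r * |x|) ∂m) + ∫ x in {0}, Real.exp (-r * |x|) ∂m := by
    rw [← setIntegral_union (by simp) (measurableSet_singleton 0) hi.integrableOn hi.integrableOn]
    congr 2
    ext x
    simp [le_iff_lt_or_eq]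
  rw [← integral_add_compl measurableSet_Ioi hi, h1, Set.compl_Ioi, h4, h2, h3]
  ring

variable {Ω : Type*} {mΩ : MeasurableSpace Ω} {μ : Measure Ω} {ξ : ℕ → Ω → ℝ}

lemma charFun_map_neg (m : Measure ℝ) (t : ℝ) :
    charFun (m.map fun x => -x) t = charFun m (-t) := by
  have := charFun_map_mul (μ := m) (-1) t
  simpa using this

lemma ofReal_re_charFun_of_symmetric (hmeas : ∀ k, Measurable (ξ k))
    (hsymm : IdentDistrib (fun ω => -ξ 0 ω) (ξ 0) μ μ) (t : ℝ) :
    ((charFun (μ.map (ξ 0)) t).re : ℂ) = charFun (μ.map (ξ 0)) t := by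
  have h1 : (μ.map (ξ 0)).map (fun x => -x) = μ.map (ξ 0) := by
    rw [Measure.map_map (by fun_prop) (hmeas 0)]
    exact hsymm.map_eq
  have h2 := charFun_map_neg (μ.map (ξ 0)) t
  rw [h1, charFun_neg] at h2
  exact Complex.conj_eq_iff_re.1 h2.symm

lemma indepFun_walk (hmeas : ∀ k, Measurable (ξ k)) (hindep : iIndepFun ξ μ) (n : ℕ) :
    IndepFun (walk ξ n) (ξ n) μ := by
  have h0 : walk ξ n = ∑ j ∈ Finset.range n, ξ j := by
    ext ω
    rw [walk, Finset.sum_apply]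
  rw [h0]
  exact hindep.indepFun_sum_range_succ hmeas n

variable [IsProbabilityMeasure μ]

lemma map_neg_map_walk (hmeas : ∀ k, Measurable (ξ k)) (hindep : iIndepFun ξ μ)
    (hident : ∀ k, IdentDistrib (ξ k) (ξ 0) μ μ)
    (hsymm : IdentDistrib (fun ω => -ξ 0 ω) (ξ 0) μ μ) (n : ℕ) :
    (μ.map (walk ξ n)).map (fun x => -x) = μ.map (walk ξ n) := by
  have := Measure.isProbabilityMeasure_map (μ := μ) (measurable_walk hmeas n).aemeasurable
  apply Measure.ext_of_charFun
  ext t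
  rw [charFun_map_neg, charFun_neg, charFun_map_walk hmeas hindep hident,
    ← ofReal_re_charFun_of_symmetric hmeas hsymm, ← Complex.ofReal_pow, Complex.conj_ofReal]

lemma two_mul_integral_walk_pos_add (hmeas : ∀ k, Measurable (ξ k)) (hindep : iIndepFun ξ μ)
    (hident : ∀ k, IdentDistrib (ξ k) (ξ 0) μ μ)
    (hsymm : IdentDistrib (fun ω => -ξ 0 ω) (ξ 0) μ μ) {r : ℝ} (hr : 0 < r) (n : ℕ) :
    2 * (∫ ω in {ω | 0 < walk ξ n ω}, Real.exp (-r * walk ξ n ω) ∂μ) +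
        μ.real {ω | walk ξ n ω = 0} =
      ∫ t, poissonKer r t * (charFun (μ.map (ξ 0)) t).re ^ n := by
  have hw := measurable_walk hmeas n
  have := Measure.isProbabilityMeasure_map (μ := μ) hw.aemeasurable
  have h1 := integral_exp_neg_abs_of_symmetric _ (map_neg_map_walk hmeas hindep hident hsymm n) hr
  rw [integral_exp_neg_abs_eq_poisson hr, setIntegral_map measurableSet_Ioi (by fun_prop)
    hw.aemeasurable, map_measureReal_apply hw (measurableSet_singleton 0)] at h1
  have h2 : ∀ t, (charFun (μ.map (walk ξ n)) t).re = (charFun (μ.map (ξ 0)) t).re ^ n := by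
    intro t
    rw [charFun_map_walk hmeas hindep hident, ← ofReal_re_charFun_of_symmetric hmeas hsymm,
      ← Complex.ofReal_pow, Complex.ofReal_re, Complex.ofReal_re]
  simp_rw [h2] at h1
  exact h1

/-- A return to `0` followed by a positive step ends in a positive position. -/
lemma measureReal_walk_eq_zero_mul_le (hmeas : ∀ k, Measurable (ξ k)) (hindep : iIndepFun ξ μ)
    (hident : ∀ k, IdentDistrib (ξ k) (ξ 0) μ μ) {r : ℝ} (hr : 0 < r) (n : ℕ) :
    μ.real {ω | walk ξ n ω = 0} * (∫ ω in {ω | 0 < ξ 0 ω}, Real.exp (-r * ξ 0 ω) ∂μ) ≤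
      ∫ ω in {ω | 0 < walk ξ (n + 1) ω}, Real.exp (-r * walk ξ (n + 1) ω) ∂μ := by
  have hw := measurable_walk hmeas
  set f : ℝ → ℝ := ({0} : Set ℝ).indicator fun _ => 1 with hf
  set g : ℝ → ℝ := (Set.Ioi (0 : ℝ)).indicator fun x => Real.exp (-r * x) with hg
  have hfm : Measurable f := measurable_const.indicator (measurableSet_singleton 0)
  have hgm : Measurable g := Measurable.indicator (by fun_prop) measurableSet_Ioi
  have hind := indepFun_walk hmeas hindep n
  have hprod := (hind.comp hfm hgm).integral_fun_mul_eq_mul_integral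
    (hfm.comp (hw n)).aestronglyMeasurable (hgm.comp (hmeas n)).aestronglyMeasurable
  have e1 : ∫ ω, (f ∘ walk ξ n) ω ∂μ = μ.real {ω | walk ξ n ω = 0} := by
    have h0 : MeasurableSet {ω | walk ξ n ω = 0} := hw n (measurableSet_singleton 0)
    have : f ∘ walk ξ n = {ω | walk ξ n ω = 0}.indicator fun _ => 1 := rfl
    rw [this, integral_indicator h0]
    simp
  have e2 : ∫ ω, (g ∘ ξ n) ω ∂μ = ∫ ω in {ω | 0 < ξ 0 ω}, Real.exp (-r * ξ 0 ω) ∂μ := by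
    rw [((hident n).comp hgm).integral_eq,
      ← integral_indicator (measurableSet_lt measurable_const (hmeas 0))]
    congr 1
  rw [e1, e2] at hprod
  rw [← hprod, ← integral_indicator (measurableSet_lt measurable_const (hw (n + 1)))]
  have hiR := (integrable_exp_neg_mul (μ := μ) (hw (n + 1)) hr.le
    (E := {ω | 0 < walk ξ (n + 1) ω}) (measurableSet_lt measurable_const (hw (n + 1)))
    fun ω hω => le_of_lt hω).integrable_indicator (measurableSet_lt measurable_const (hw (n + 1)))
  refine integral_mono_of_nonneg (ae_of_all _ fun ω => ?_) hiR (ae_of_all _ fun ω => ?_)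
  · exact mul_nonneg (Set.indicator_nonneg (fun _ _ => zero_le_one) _)
      (Set.indicator_nonneg (fun _ _ => (Real.exp_pos _).le) _)
  · simp only [Function.comp]
    by_cases h1 : walk ξ n ω = 0
    · have h2 : walk ξ (n + 1) ω = ξ n ω := by
        have : walk ξ (n + 1) ω = walk ξ n ω + ξ n ω := by simp [walk, Finset.sum_range_succ]
        rw [this, h1, zero_add]
      by_cases h3 : 0 < ξ n ω
      · rw [Set.indicator_of_mem (show ω ∈ {ω | 0 < walk ξ (n + 1) ω} by
          rw [Set.mem_ofPred_eq, h2]; exact h3), h2]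
        simp [hf, hg, h1, h3]
      · have : g (ξ n ω) = 0 := Set.indicator_of_notMem (by simpa using h3) _
        rw [this, mul_zero]
        exact Set.indicator_nonneg (fun _ _ => (Real.exp_pos _).le) _
    · have : f (walk ξ n ω) = 0 := Set.indicator_of_notMem (by simpa using h1) _
      rw [this, zero_mul]
      exact Set.indicator_nonneg (fun _ _ => (Real.exp_pos _).le) _

/-- Convergence of the series comes from that of `∑ 𝔼[exp (-S_n); S_n > 0] / n`, since a return to
`0` at time `n` is followed by a positive step with a fixed positive probability. -/
lemma summable_measureReal_walk_eq_zero (hmeas : ∀ k, Measurable (ξ k)) (hindep : iIndepFun ξ μ)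
    (hident : ∀ k, IdentDistrib (ξ k) (ξ 0) μ μ) (hpos : 0 < μ {ω | 0 < ξ 0 ω}) :
    Summable (fun n : ℕ => μ.real {ω | walk ξ (n + 1) ω = 0} / (n + 1)) := by
  have hE : MeasurableSet {ω | 0 < ξ 0 ω} := measurableSet_lt measurable_const (hmeas 0)
  set c : ℝ := ∫ ω in {ω | 0 < ξ 0 ω}, Real.exp (-1 * ξ 0 ω) ∂μ with hc
  have hc0 : 0 < c := by
    rw [hc, setIntegral_pos_iff_support_of_nonneg_ae (ae_of_all _ fun ω => (Real.exp_pos _).le)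
      (integrable_exp_neg_mul (hmeas 0) zero_le_one hE fun ω hω => le_of_lt hω)]
    have : Function.support (fun ω => Real.exp (-1 * ξ 0 ω)) = Set.univ := by
      ext ω
      simp
    rwa [this, Set.univ_inter]
  have hs := (summable_nat_add_iff 1).2
    (summable_and_one_sub_laplace_leapover hmeas hindep hident one_pos).1
  refine Summable.of_nonneg_of_le (fun n => div_nonneg measureReal_nonneg (by positivity))
    (fun n => ?_) (hs.mul_left (2 * c⁻¹))
  have h1 := measureReal_walk_eq_zero_mul_le hmeas hindep hident one_pos (n + 1)
  rw [← hc] at h1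
  set e : ℝ := ∫ ω in {ω | 0 < walk ξ (n + 1 + 1) ω},
    Real.exp (-1 * walk ξ (n + 1 + 1) ω) ∂μ with he
  have he0 : 0 ≤ e := integral_nonneg fun ω => (Real.exp_pos _).le
  have h2 : μ.real {ω | walk ξ (n + 1) ω = 0} ≤ c⁻¹ * e := by
    rw [← div_eq_inv_mul, le_div_iff₀ hc0]
    exact h1
  push_cast
  rw [div_le_iff₀ (by positivity)]
  refine h2.trans ?_
  have h3 : (1 : ℝ) ≤ 2 / ((n : ℝ) + 1 + 1) * (n + 1) := by
    rw [div_mul_eq_mul_div, le_div_iff₀ (by positivity)]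
    linarith [Nat.cast_nonneg (α := ℝ) n]
  calc c⁻¹ * e = c⁻¹ * e * 1 := (mul_one _).symm
    _ ≤ c⁻¹ * e * (2 / ((n : ℝ) + 1 + 1) * (n + 1)) :=
      mul_le_mul_of_nonneg_left h3 (mul_nonneg (inv_nonneg.2 hc0.le) he0)
    _ = 2 * c⁻¹ * (e / ((n : ℝ) + 1 + 1)) * (n + 1) := by ring

lemma abs_re_charFun_le_one (m : Measure ℝ) [IsProbabilityMeasure m] (t : ℝ) :
    |(charFun m t).re| ≤ 1 :=
  (Complex.abs_re_le_norm _).trans (norm_charFun_le_one t)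

/-- The Laplace transform of the first-ladder height of a symmetric walk. By symmetry the exponent
`∑ 𝔼[exp (-r S_n); S_n > 0] / n` is one half of `∑ (𝔼[exp (-r |S_n|)] - ℙ(S_n = 0)) / n`, and
`𝔼[exp (-r |S_n|)]` is the Poisson integral of `φ ^ n`. -/
theorem one_sub_laplace_leapover_eq (hmeas : ∀ k, Measurable (ξ k)) (hindep : iIndepFun ξ μ)
    (hident : ∀ k, IdentDistrib (ξ k) (ξ 0) μ μ)
    (hsymm : IdentDistrib (fun ω => -ξ 0 ω) (ξ 0) μ μ) (hpos : 0 < μ {ω | 0 < ξ 0 ω})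
    {r : ℝ} (hr : 0 < r) :
    Integrable (fun t => poissonKer r t * Real.log (1 - (charFun (μ.map (ξ 0)) t).re)) ∧
      1 - ∫ ω in ladderExists ξ, Real.exp (-r * leapover ξ ω) ∂μ = walkPhi μ ξ *
        Real.exp ((1 / 2) *
          ∫ t, poissonKer r t * Real.log (1 - (charFun (μ.map (ξ 0)) t).re)) := by
  have := Measure.isProbabilityMeasure_map (μ := μ) (hmeas 0).aemeasurable
  obtain ⟨h1, h2⟩ := summable_and_one_sub_laplace_leapover hmeas hindep hident hr
  have h3 := summable_measureReal_walk_eq_zero hmeas hindep hident hpos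
  have h4 : ∀ n : ℕ, (2 * (∫ ω in {ω | 0 < walk ξ (n + 1) ω},
      Real.exp (-r * walk ξ (n + 1) ω) ∂μ) + μ.real {ω | walk ξ (n + 1) ω = 0}) / (n + 1) =
      2 * ((∫ ω in {ω | 0 < walk ξ (n + 1) ω},
        Real.exp (-r * walk ξ (n + 1) ω) ∂μ) / (n + 1)) +
        μ.real {ω | walk ξ (n + 1) ω = 0} / (n + 1) := fun n => by ring
  obtain ⟨h5, h6⟩ := integrable_log_one_sub_and_tsum (poissonKer_pos hr)
    (continuous_poissonKer hr).measurable (integrable_poissonKer hr)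
    (Complex.measurable_re.comp (measurable_charFun (μ := μ.map (ξ 0))))
    (abs_re_charFun_le_one _)
    (fun n => two_mul_integral_walk_pos_add hmeas hindep hident hsymm hr (n + 1))
    (fun n => add_nonneg (mul_nonneg zero_le_two (integral_nonneg fun ω => (Real.exp_pos _).le))
      measureReal_nonneg)
    (by simp_rw [h4]; exact (h1.mul_left 2).add h3)
  refine ⟨h5, ?_⟩
  simp_rw [h4] at h6
  rw [(h1.mul_left 2).tsum_add h3, tsum_mul_left] at h6
  rw [h2, walkPhi, ← Real.exp_add]
  congr 1
  simp only [Function.comp] at h6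
  linarith

end Symmetric

/-! ### The Poisson integral of a function with a logarithmic singularity at the origin -/

section LogAsymptotics

lemma integrableOn_Ioi_inv_one_add_sq_mul_log :
    IntegrableOn (fun t : ℝ => (1 + t ^ 2)⁻¹ * Real.log t) (Set.Ioi 0) := by
  rw [← Set.Ioc_union_Ioi_eq_Ioi (zero_le_one (α := ℝ))]
  refine IntegrableOn.union ?_ ?_
  · have h1 : IntegrableOn Real.log (Set.Ioc 0 1) := by
      rw [← intervalIntegrable_iff_integrableOn_Ioc_of_le zero_le_one]
      exact intervalIntegral.intervalIntegrable_log'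
    refine Integrable.bdd_mul (c := 1) h1 (by fun_prop) (ae_of_all _ fun t => ?_)
    rw [Real.norm_of_nonneg (by positivity)]
    exact inv_le_one_of_one_le₀ (by nlinarith [sq_nonneg t])
  · have h1 : IntegrableOn (fun t : ℝ => 2 * t ^ (-(3 / 2) : ℝ)) (Set.Ioi 1) :=
      (integrableOn_Ioi_rpow_of_lt (by norm_num) one_pos).const_mul 2
    refine Integrable.mono' h1 (by fun_prop) ?_
    filter_upwards [ae_restrict_mem measurableSet_Ioi] with t ht
    have ht1 : (1 : ℝ) < t := ht
    have ht0 : (0 : ℝ) < t := one_pos.trans ht1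
    rw [norm_mul, Real.norm_of_nonneg (by positivity), Real.norm_of_nonneg (Real.log_nonneg ht1.le)]
    have h2 := Real.log_le_rpow_div ht0.le (show (0 : ℝ) < 1 / 2 by norm_num)
    have h3 : (1 + t ^ 2)⁻¹ ≤ t ^ (-2 : ℝ) := by
      rw [Real.rpow_neg ht0.le, Real.rpow_two]
      exact inv_anti₀ (by positivity) (by linarith)
    calc (1 + t ^ 2)⁻¹ * Real.log t ≤ t ^ (-2 : ℝ) * (t ^ (1 / 2 : ℝ) / (1 / 2)) :=
          mul_le_mul h3 h2 (Real.log_nonneg ht1.le) (by positivity)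
      _ = 2 * (t ^ (-2 : ℝ) * t ^ (1 / 2 : ℝ)) := by ring
      _ = 2 * t ^ (-(3 / 2) : ℝ) := by
          rw [← Real.rpow_add ht0]
          norm_num

lemma integral_Ioi_inv_one_add_sq_mul_log :
    ∫ t in Set.Ioi (0 : ℝ), (1 + t ^ 2)⁻¹ * Real.log t = 0 := by
  have h := integral_comp_rpow_Ioi (fun t : ℝ => (1 + t ^ 2)⁻¹ * Real.log t)
    (show (-1 : ℝ) ≠ 0 by norm_num)
  -- the substitution `t ↦ t⁻¹` changes the sign of the integrand
  have h2 : ∫ x in Set.Ioi (0 : ℝ), (|(-1 : ℝ)| * x ^ ((-1 : ℝ) - 1)) •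
      ((1 + (x ^ (-1 : ℝ)) ^ 2)⁻¹ * Real.log (x ^ (-1 : ℝ))) =
      ∫ x in Set.Ioi (0 : ℝ), -((1 + x ^ 2)⁻¹ * Real.log x) := by
    refine setIntegral_congr_fun measurableSet_Ioi fun x hx => ?_
    have hx0 : (0 : ℝ) < x := hx
    simp only [smul_eq_mul]
    rw [Real.log_rpow hx0, Real.rpow_neg_one, show (-1 : ℝ) - 1 = -2 by norm_num,
      Real.rpow_neg hx0.le, Real.rpow_two, abs_neg, abs_one]
    field_simp
    ring
  rw [h2, integral_neg] at h
  linarith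

lemma integrable_inv_one_add_sq_mul_log :
    Integrable (fun t : ℝ => (1 + t ^ 2)⁻¹ * Real.log t) := by
  have h1 := integrableOn_Ioi_inv_one_add_sq_mul_log
  have h2 : IntegrableOn (fun t : ℝ => (1 + t ^ 2)⁻¹ * Real.log t) (Set.Iic 0) := by
    rw [integrableOn_Iic_iff_integrableOn_Iio]
    have h3 : IntegrableOn (fun t : ℝ => (1 + t ^ 2)⁻¹ * Real.log t) (Set.Ioi (-0)) := by
      rwa [neg_zero]
    refine h3.comp_neg_Iio.congr_fun (fun t _ => ?_) measurableSet_Iio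
    simp
  rw [← integrableOn_univ, ← Set.Iic_union_Ioi (a := (0 : ℝ))]
  exact h2.union h1

lemma integral_inv_one_add_sq_mul_log : ∫ t : ℝ, (1 + t ^ 2)⁻¹ * Real.log t = 0 := by
  have h := integral_comp_abs (f := fun t : ℝ => (1 + t ^ 2)⁻¹ * Real.log t)
  simpa [integral_Ioi_inv_one_add_sq_mul_log] using h

lemma integral_poissonKer_mul_log {r : ℝ} (hr : 0 < r) :
    Integrable (fun t => poissonKer r t * Real.log t) ∧
      ∫ t, poissonKer r t * Real.log t = Real.log r := by
  set F : ℝ → ℝ := fun u => Real.pi⁻¹ * (Real.log r * (1 + u ^ 2)⁻¹ +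
    (1 + u ^ 2)⁻¹ * Real.log u) with hF
  have hFi : Integrable F := ((integrable_inv_one_add_sq.const_mul _).add
    integrable_inv_one_add_sq_mul_log).const_mul _
  have hae : (fun t => poissonKer r t * Real.log t) =ᵐ[volume] fun t => r⁻¹ * F (t / r) := by
    have : ∀ᵐ t : ℝ, t ≠ 0 := by simp [ae_iff]
    filter_upwards [this] with t ht
    have : Real.log t = Real.log r + Real.log (t / r) := by
      rw [Real.log_div ht hr.ne']
      ring
    rw [poissonKer_eq hr, this]
    simp only [hF]
    ring
  refine ⟨((hFi.comp_div hr.ne').const_mul _).congr hae.symm, ?_⟩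
  rw [integral_congr_ae hae, integral_const_mul, Measure.integral_comp_div F, abs_of_pos hr,
    smul_eq_mul, inv_mul_cancel_left₀ hr.ne']
  simp only [hF]
  rw [integral_const_mul, integral_add (integrable_inv_one_add_sq.const_mul _)
    integrable_inv_one_add_sq_mul_log, integral_inv_one_add_sq_mul_log, integral_const_mul,
    integral_univ_inv_one_add_sq]
  have := Real.pi_pos
  field_simp
  ring

/-- The Poisson kernels are an approximate identity as the scale tends to zero, also for functions
`g` that are unbounded away from the origin: there the kernel of scale `r` is at most a multiple of
`r` times the kernel of scale `1`. -/
lemma tendsto_integral_poissonKer_mul {g : ℝ → ℝ} (hg : Integrable fun t => poissonKer 1 t * g t)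
    (hlim : Tendsto g (𝓝[≠] 0) (𝓝 0)) :
    Tendsto (fun r => ∫ t, poissonKer r t * g t) (𝓝[>] 0) (𝓝 0) := by
  rw [Metric.tendsto_nhds]
  intro ε hε
  obtain ⟨δ, hδ, hδg⟩ : ∃ δ > 0, ∀ t : ℝ, t ≠ 0 → |t| < δ → |g t| ≤ ε / 2 := by
    have := (Metric.tendsto_nhdsWithin_nhds.1 hlim) (ε / 2) (by positivity)
    obtain ⟨δ, hδ, h⟩ := this
    exact ⟨δ, hδ, fun t ht htδ => by simpa using (h ht (by simpa using htδ)).le⟩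
  set C : ℝ := (1 + (δ ^ 2)⁻¹) * ∫ t, |poissonKer 1 t * g t| with hC
  have hC0 : 0 ≤ C := mul_nonneg (by positivity) (integral_nonneg fun t => abs_nonneg _)
  have hsmall : ∀ᶠ r : ℝ in 𝓝[>] 0, r * C < ε / 2 := by
    have h1 : Tendsto (fun r : ℝ => r * C) (𝓝[>] 0) (𝓝 0) := by
      have : Tendsto (fun r : ℝ => r * C) (𝓝 0) (𝓝 (0 * C)) := tendsto_id.mul_const C
      rw [zero_mul] at this
      exact this.mono_left nhdsWithin_le_nhds
    exact h1.eventually_lt_const (by positivity)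
  filter_upwards [hsmall, self_mem_nhdsWithin] with r hrC hr
  have hr0 : (0 : ℝ) < r := hr
  have hbound : ∀ᵐ t : ℝ, ‖poissonKer r t * g t‖ ≤
      poissonKer r t * (ε / 2) + r * (1 + (δ ^ 2)⁻¹) * |poissonKer 1 t * g t| := by
    have : ∀ᵐ t : ℝ, t ≠ 0 := by simp [ae_iff]
    filter_upwards [this] with t ht
    rw [norm_mul, Real.norm_of_nonneg (poissonKer_nonneg hr0 t), Real.norm_eq_abs]
    have hA : 0 ≤ poissonKer r t * (ε / 2) := mul_nonneg (poissonKer_nonneg hr0 t) (by positivity)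
    have hB : 0 ≤ r * (1 + (δ ^ 2)⁻¹) * |poissonKer 1 t * g t| := by positivity
    rcases lt_or_ge |t| δ with h | h
    · linarith [mul_le_mul_of_nonneg_left (hδg t ht h) (poissonKer_nonneg hr0 t)]
    · have hK : poissonKer r t ≤ r * (1 + (δ ^ 2)⁻¹) * poissonKer 1 t := by
        have ht2 : δ ^ 2 ≤ t ^ 2 := by
          rw [← sq_abs t]
          exact pow_le_pow_left₀ hδ.le h 2
        have ht2' : 0 < t ^ 2 := by positivity
        have h1 : r / (r ^ 2 + t ^ 2) ≤ r * (1 + (δ ^ 2)⁻¹) * (1 / (1 ^ 2 + t ^ 2)) := by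
          rw [one_pow, mul_one_div, div_le_div_iff₀ (by positivity) (by positivity), mul_assoc]
          refine mul_le_mul_of_nonneg_left ?_ hr0.le
          have h2 : 1 ≤ (δ ^ 2)⁻¹ * t ^ 2 := by
            rw [← div_eq_inv_mul, one_le_div (by positivity)]
            exact ht2
          have h3 : 0 ≤ (δ ^ 2)⁻¹ := by positivity
          nlinarith [sq_nonneg r, mul_nonneg h3 (sq_nonneg r)]
        unfold poissonKer
        calc Real.pi⁻¹ * (r / (r ^ 2 + t ^ 2))
            ≤ Real.pi⁻¹ * (r * (1 + (δ ^ 2)⁻¹) * (1 / (1 ^ 2 + t ^ 2))) :=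
              mul_le_mul_of_nonneg_left h1 (by positivity)
          _ = r * (1 + (δ ^ 2)⁻¹) * (Real.pi⁻¹ * (1 / (1 ^ 2 + t ^ 2))) := by ring
      have := mul_le_mul_of_nonneg_right hK (abs_nonneg (g t))
      rw [abs_mul, abs_of_nonneg (poissonKer_nonneg one_pos t), ← mul_assoc]
      linarith
  have hle := norm_integral_le_of_norm_le
    (((integrable_poissonKer hr0).mul_const (ε / 2)).add (hg.abs.const_mul _)) hbound
  rw [integral_add' ((integrable_poissonKer hr0).mul_const (ε / 2)) (hg.abs.const_mul _),
    integral_mul_const, integral_poissonKer hr0, integral_const_mul, one_mul, mul_assoc,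
    ← hC] at hle
  rw [dist_zero_right]
  linarith

/-- Poisson integrals of a function that behaves like `log (ν |t| ^ β)` at the origin. The Poisson
integral of `log (ν |t| ^ β)` itself is `log (ν r ^ β)`, by the symmetry `t ↦ r² / t`. -/
lemma tendsto_integral_poissonKer_mul_sub_log {ψ : ℝ → ℝ} {β ν : ℝ} (hν : 0 < ν)
    (hψ : ∀ r, 0 < r → Integrable fun t => poissonKer r t * ψ t) (heven : ∀ t, ψ (-t) = ψ t)
    (hlim : Tendsto (fun t => ψ t - Real.log (ν * t ^ β)) (𝓝[>] 0) (𝓝 0)) :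
    Tendsto (fun r => (∫ t, poissonKer r t * ψ t) - Real.log (ν * r ^ β)) (𝓝[>] 0) (𝓝 0) := by
  set g : ℝ → ℝ := fun t => ψ t - (Real.log ν + β * Real.log t) with hg
  have hlogeq : ∀ t : ℝ, 0 < t → Real.log (ν * t ^ β) = Real.log ν + β * Real.log t := by
    intro t ht
    rw [Real.log_mul hν.ne' (Real.rpow_pos_of_pos ht β).ne', Real.log_rpow ht]
  have hK : ∀ r, 0 < r → Integrable fun t => poissonKer r t * (Real.log ν + β * Real.log t) := by
    intro r hr
    have := ((integrable_poissonKer hr).mul_const (Real.log ν)).add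
      ((integral_poissonKer_mul_log hr).1.const_mul β)
    refine this.congr (ae_of_all _ fun t => ?_)
    simp only [Pi.add_apply]
    ring
  have hgi : ∀ r, 0 < r → Integrable fun t => poissonKer r t * g t := by
    intro r hr
    refine ((hψ r hr).sub (hK r hr)).congr (ae_of_all _ fun t => ?_)
    simp only [Pi.sub_apply, hg]
    ring
  have hg0 : Tendsto g (𝓝[>] 0) (𝓝 0) := by
    refine hlim.congr' ?_
    filter_upwards [self_mem_nhdsWithin] with t ht
    rw [hlogeq t ht]
  have hg1 : Tendsto g (𝓝[<] 0) (𝓝 0) := by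
    have h1 : Tendsto (fun t : ℝ => -t) (𝓝[<] 0) (𝓝[>] 0) := by
      have := tendsto_neg_nhdsLT (a := (0 : ℝ))
      rwa [neg_zero] at this
    refine (hg0.comp h1).congr fun t => ?_
    simp [hg, heven]
  have hg2 : Tendsto g (𝓝[≠] 0) (𝓝 0) := by
    rw [← nhdsLT_sup_nhdsGT]
    exact hg1.sup hg0
  refine (tendsto_integral_poissonKer_mul (hgi 1 one_pos) hg2).congr' ?_
  filter_upwards [self_mem_nhdsWithin] with r hr
  have hr0 : (0 : ℝ) < r := hr
  have h1 : ∫ t, poissonKer r t * (Real.log ν + β * Real.log t) = Real.log (ν * r ^ β) := by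
    simp_rw [mul_add, mul_left_comm _ β]
    rw [integral_add ((integrable_poissonKer hr0).mul_const _)
      ((integral_poissonKer_mul_log hr0).1.const_mul β), integral_mul_const,
      integral_poissonKer hr0, integral_const_mul, (integral_poissonKer_mul_log hr0).2,
      hlogeq r hr0, one_mul]
  rw [← h1, ← integral_sub (hψ r hr0) (hK r hr0)]
  congr 1 with t
  simp only [hg]
  ring

end LogAsymptotics

/-! ### Laplace transforms on the half-line: weak convergence and uniqueness -/

section Laplace

lemma ae_nonneg_of_Iio {m : Measure ℝ} (hm : m (Set.Iio 0) = 0) : ∀ᵐ x ∂m, 0 ≤ x := by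
  rw [ae_iff]
  simpa [Set.Iio] using hm

lemma integrable_comp_exp_neg {ν : Measure ℝ} [IsFiniteMeasure ν] (hν : ν (Set.Iio 0) = 0)
    {g : ℝ → ℝ} (hg : Continuous g) : Integrable (fun x => g (Real.exp (-x))) ν := by
  obtain ⟨C, hC⟩ := isCompact_Icc.exists_bound_of_continuousOn
    (hg.continuousOn (s := Set.Icc (0 : ℝ) 1))
  have hae : ∀ᵐ x ∂ν, 0 ≤ x := by
    rw [ae_iff]
    simpa [Set.Iio] using hν
  refine Integrable.of_bound (by fun_prop) C ?_
  filter_upwards [hae] with x hx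
  exact hC _ ⟨(Real.exp_pos _).le, Real.exp_le_one_iff.2 (by linarith)⟩

/-- Convergence of the Laplace transforms at the natural numbers gives convergence of the integrals
of all continuous functions of `exp (-x)`, by Weierstrass approximation on `[0, 1]`. -/
lemma tendsto_integral_comp_exp_neg {ι : Type*} {l : Filter ι} {ν : ι → Measure ℝ}
    {ν₀ : Measure ℝ} [∀ i, IsFiniteMeasure (ν i)] [IsFiniteMeasure ν₀]
    (hν : ∀ i, ν i (Set.Iio 0) = 0) (hν₀ : ν₀ (Set.Iio 0) = 0)
    (hk : ∀ k : ℕ, Tendsto (fun i => ∫ x, Real.exp (-(k * x)) ∂(ν i)) l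
      (𝓝 (∫ x, Real.exp (-(k * x)) ∂ν₀))) {g : ℝ → ℝ} (hg : Continuous g) :
    Tendsto (fun i => ∫ x, g (Real.exp (-x)) ∂(ν i)) l (𝓝 (∫ x, g (Real.exp (-x)) ∂ν₀)) := by
  have hpoly : ∀ p : Polynomial ℝ, Tendsto (fun i => ∫ x, p.eval (Real.exp (-x)) ∂(ν i)) l
      (𝓝 (∫ x, p.eval (Real.exp (-x)) ∂ν₀)) := by
    intro p
    have hexp : ∀ τ : Measure ℝ, IsFiniteMeasure τ → τ (Set.Iio 0) = 0 →
        ∫ x, p.eval (Real.exp (-x)) ∂τ =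
          ∑ k ∈ Finset.range (p.natDegree + 1), p.coeff k * ∫ x, Real.exp (-(k * x)) ∂τ := by
      intro τ _ hτ
      simp_rw [Polynomial.eval_eq_sum_range]
      rw [integral_finsetSum]
      · refine Finset.sum_congr rfl fun k _ => ?_
        rw [integral_const_mul]
        congr 2 with x
        rw [← Real.exp_nat_mul]
        ring_nf
      · intro k _
        exact integrable_comp_exp_neg hτ (g := fun y => p.coeff k * y ^ k) (by fun_prop)
    rw [hexp ν₀ inferInstance hν₀]
    simp_rw [fun i => hexp (ν i) inferInstance (hν i)]
    exact tendsto_finsetSum _ fun k _ => (hk k).const_mul _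
  have hmass : Tendsto (fun i => (ν i).real Set.univ) l (𝓝 (ν₀.real Set.univ)) := by
    simpa using hk 0
  set M : ℝ := ν₀.real Set.univ with hM
  have hM0 : 0 ≤ M := measureReal_nonneg
  rw [Metric.tendsto_nhds]
  intro ε hε
  set η : ℝ := ε / (2 * M + 2) with hη
  have hη0 : 0 < η := by positivity
  obtain ⟨p, hp⟩ := exists_polynomial_near_of_continuousOn 0 1 g hg.continuousOn η hη0
  have happrox : ∀ τ : Measure ℝ, IsFiniteMeasure τ → τ (Set.Iio 0) = 0 →
      |(∫ x, g (Real.exp (-x)) ∂τ) - ∫ x, p.eval (Real.exp (-x)) ∂τ| ≤ η * τ.real Set.univ := by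
    intro τ _ hτ
    rw [← integral_sub (integrable_comp_exp_neg hτ hg)
      (integrable_comp_exp_neg hτ (g := fun y => p.eval y) (by fun_prop))]
    have hae := ae_nonneg_of_Iio hτ
    refine norm_integral_le_of_norm_le_const (μ := τ)
      (f := fun x => g (Real.exp (-x)) - p.eval (Real.exp (-x))) ?_
    filter_upwards [hae] with x hx
    rw [Real.norm_eq_abs, abs_sub_comm]
    exact (hp _ ⟨(Real.exp_pos _).le, Real.exp_le_one_iff.2 (by linarith)⟩).le
  have hη2 : η * (2 * M + 2) = ε := by
    rw [hη]
    field_simp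
  filter_upwards [(Metric.tendsto_nhds.1 (hpoly p)) (η / 2) (by positivity),
    hmass.eventually_lt_const (show M < M + 1 / 2 by linarith)] with i hi1 hi2
  have a1 := abs_le.1 (happrox (ν i) inferInstance (hν i))
  have a2 := abs_le.1 (happrox ν₀ inferInstance hν₀)
  rw [Real.dist_eq, abs_lt] at hi1
  rw [Real.dist_eq, abs_lt]
  have a3 : η * (ν i).real Set.univ ≤ η * (M + 1 / 2) := mul_le_mul_of_nonneg_left hi2.le hη0.le
  constructor <;> linarith

/-- A finite measure on `[0, ∞)` is determined by its Laplace transform at the natural numbers. -/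
lemma eq_of_laplace_eq {ν ν' : Measure ℝ} [IsFiniteMeasure ν] [IsFiniteMeasure ν']
    (hν : ν (Set.Iio 0) = 0) (hν' : ν' (Set.Iio 0) = 0)
    (h : ∀ k : ℕ, ∫ x, Real.exp (-(k * x)) ∂ν = ∫ x, Real.exp (-(k * x)) ∂ν') : ν = ν' := by
  have hmap : ν.map (fun x => Real.exp (-x)) = ν'.map (fun x => Real.exp (-x)) := by
    refine ext_of_forall_integral_eq_of_IsFiniteMeasure fun f => ?_
    rw [integral_map (by fun_prop) (by fun_prop), integral_map (by fun_prop) (by fun_prop)]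
    have := tendsto_integral_comp_exp_neg (l := (atTop : Filter ℕ)) (ν := fun _ => ν) (fun _ => hν)
      hν' (fun k => by rw [h k]; exact tendsto_const_nhds) f.continuous
    exact tendsto_nhds_unique tendsto_const_nhds this
  have hinv : ∀ τ : Measure ℝ,
      (τ.map fun x => Real.exp (-x)).map (fun y => -Real.log y) = τ := by
    intro τ
    rw [Measure.map_map (by fun_prop) (by fun_prop)]
    convert Measure.map_id
    ext x
    simp
  rw [← hinv ν, hmap, hinv ν']

end Laplace

/-! ### A Tauberian theorem for monotone functions -/

section Tauberian

/-- The measure on `(0, ∞)` with density `h`. -/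
noncomputable def halfLineMeasure (h : ℝ → ℝ) : Measure ℝ :=
  (volume.restrict (Set.Ioi 0)).withDensity fun x => ENNReal.ofReal (h x)

lemma halfLineMeasure_Iio (h : ℝ → ℝ) : halfLineMeasure h (Set.Iio 0) = 0 := by
  refine withDensity_absolutelyContinuous _ _ ?_
  rw [Measure.restrict_apply measurableSet_Iio]
  convert measure_empty (μ := volume)
  ext x
  simp only [Set.mem_inter_iff, Set.mem_Iio, Set.mem_Ioi, Set.mem_empty_iff_false, iff_false]
  exact fun hx => lt_asymm hx.1 hx.2

lemma isFiniteMeasure_halfLineMeasure {h : ℝ → ℝ} (hi : IntegrableOn h (Set.Ioi 0)) :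
    IsFiniteMeasure (halfLineMeasure h) :=
  isFiniteMeasure_withDensity_ofReal hi.2

lemma integral_halfLineMeasure {h : ℝ → ℝ} (hm : Measurable h) (h0 : ∀ x, 0 < x → 0 ≤ h x)
    (f : ℝ → ℝ) : ∫ x, f x ∂(halfLineMeasure h) = ∫ x in Set.Ioi 0, h x * f x := by
  rw [halfLineMeasure, integral_withDensity_eq_integral_toReal_smul (by fun_prop)
    (ae_of_all _ fun x => ENNReal.ofReal_lt_top)]
  refine setIntegral_congr_fun measurableSet_Ioi fun x hx => ?_
  simp only [smul_eq_mul]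
  rw [ENNReal.toReal_ofReal (h0 x hx)]

/-- A continuous function of `y = exp (-x)` that is positive exactly for `a < x < b`. It is used in
place of an indicator function, so that weak convergence applies to it directly. -/
noncomputable def expBump (a b y : ℝ) : ℝ :=
  max 0 ((Real.exp (-a) - y) * (y - Real.exp (-b)))

lemma continuous_expBump (a b : ℝ) : Continuous (expBump a b) := by
  unfold expBump
  fun_prop

lemma expBump_nonneg (a b y : ℝ) : 0 ≤ expBump a b y := le_max_left _ _

lemma expBump_pos {a b x : ℝ} (ha : a < x) (hb : x < b) : 0 < expBump a b (Real.exp (-x)) := by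
  refine lt_max_of_lt_right (mul_pos ?_ ?_) <;>
  · rw [sub_pos]
    exact Real.exp_lt_exp.2 (by linarith)

lemma expBump_eq_zero {a b x : ℝ} (hab : a < b) (h : x < a ∨ b < x) :
    expBump a b (Real.exp (-x)) = 0 := by
  have hE : Real.exp (-b) < Real.exp (-a) := Real.exp_lt_exp.2 (by linarith)
  refine max_eq_left ?_
  rcases h with h | h
  · have : Real.exp (-a) < Real.exp (-x) := Real.exp_lt_exp.2 (by linarith)
    exact mul_nonpos_of_nonpos_of_nonneg (by linarith) (by linarith)
  · have : Real.exp (-x) < Real.exp (-b) := Real.exp_lt_exp.2 (by linarith)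
    exact mul_nonpos_of_nonneg_of_nonpos (by linarith) (by linarith)

lemma integrableOn_expBump_mul (a b : ℝ) :
    IntegrableOn (fun x => expBump a b (Real.exp (-x)) * Real.exp (-x)) (Set.Ioi 0) := by
  obtain ⟨C, hC⟩ := isCompact_Icc.exists_bound_of_continuousOn
    ((continuous_expBump a b).continuousOn (s := Set.Icc (0 : ℝ) 1))
  have hcont := continuous_expBump a b
  refine Integrable.bdd_mul (c := C) (integrableOn_exp_neg_Ioi 0) (by fun_prop) ?_
  filter_upwards [ae_restrict_mem measurableSet_Ioi] with x hx
  exact hC _ ⟨(Real.exp_pos _).le, Real.exp_le_one_iff.2 (by linarith [Set.mem_Ioi.1 hx])⟩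

/-- Comparison of `∫ v * w` with the values of an antitone `v` at the ends of the interval that
carries the weight `w`. -/
lemma integral_expBump_mul_mem {a b : ℝ} (ha : 0 < a) (hab : a < b) {v : ℝ → ℝ}
    (hv : AntitoneOn v (Set.Ioi 0)) (hvm : Measurable v) :
    v b * (∫ x in Set.Ioi 0, expBump a b (Real.exp (-x)) * Real.exp (-x)) ≤
        ∫ x in Set.Ioi 0, v x * Real.exp (-x) * expBump a b (Real.exp (-x)) ∧
      ∫ x in Set.Ioi 0, v x * Real.exp (-x) * expBump a b (Real.exp (-x)) ≤
        v a * ∫ x in Set.Ioi 0, expBump a b (Real.exp (-x)) * Real.exp (-x) := by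
  have hcont := continuous_expBump a b
  have hi := integrableOn_expBump_mul a b
  have hpt : ∀ x, 0 < x →
      v b * (expBump a b (Real.exp (-x)) * Real.exp (-x)) ≤
        v x * Real.exp (-x) * expBump a b (Real.exp (-x)) ∧
      v x * Real.exp (-x) * expBump a b (Real.exp (-x)) ≤
        v a * (expBump a b (Real.exp (-x)) * Real.exp (-x)) := by
    intro x hx
    by_cases h : a ≤ x ∧ x ≤ b
    · have h1 := hv hx (show b ∈ Set.Ioi 0 from ha.trans hab) h.2
      have h2 := hv (show a ∈ Set.Ioi 0 from ha) hx h.1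
      have h3 : 0 ≤ expBump a b (Real.exp (-x)) * Real.exp (-x) :=
        mul_nonneg (expBump_nonneg _ _ _) (Real.exp_pos _).le
      rw [mul_assoc, mul_comm (Real.exp (-x))]
      exact ⟨mul_le_mul_of_nonneg_right h1 h3, mul_le_mul_of_nonneg_right h2 h3⟩
    · rw [expBump_eq_zero hab (by by_contra! h'; exact h ⟨h'.1, h'.2⟩)]
      simp
  have hmid : IntegrableOn (fun x => v x * Real.exp (-x) * expBump a b (Real.exp (-x)))
      (Set.Ioi 0) := by
    refine Integrable.mono' (hi.const_mul (|v a| + |v b|)) (by fun_prop) ?_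
    filter_upwards [ae_restrict_mem measurableSet_Ioi] with x hx
    obtain ⟨h1, h2⟩ := hpt x hx
    have h3 : 0 ≤ expBump a b (Real.exp (-x)) * Real.exp (-x) :=
      mul_nonneg (expBump_nonneg _ _ _) (Real.exp_pos _).le
    have h4 := mul_le_mul_of_nonneg_right (le_abs_self (v a)) h3
    have h5 := mul_le_mul_of_nonneg_right (neg_abs_le (v b)) h3
    have h6 := mul_nonneg (abs_nonneg (v a)) h3
    have h7 := mul_nonneg (abs_nonneg (v b)) h3
    rw [Real.norm_eq_abs, abs_le]
    constructor <;> linarith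
  constructor
  · rw [← integral_const_mul]
    exact setIntegral_mono_on (hi.const_mul _) hmid measurableSet_Ioi fun x hx => (hpt x hx).1
  · rw [← integral_const_mul]
    exact setIntegral_mono_on hmid (hi.const_mul _) measurableSet_Ioi fun x hx => (hpt x hx).2

lemma integral_expBump_pos {a b : ℝ} (ha : 0 < a) (hab : a < b) :
    0 < ∫ x in Set.Ioi 0, expBump a b (Real.exp (-x)) * Real.exp (-x) := by
  rw [setIntegral_pos_iff_support_of_nonneg_ae (ae_of_all _ fun x =>
    mul_nonneg (expBump_nonneg _ _ _) (Real.exp_pos _).le) (integrableOn_expBump_mul a b)]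
  refine lt_of_lt_of_le (b := volume (Set.Ioo a b)) (by simpa using hab) (measure_mono ?_)
  intro x hx
  exact ⟨(mul_pos (expBump_pos hx.1 hx.2) (Real.exp_pos _)).ne', ha.trans hx.1⟩

/-- **Karamata's Tauberian theorem** with the monotone density theorem, for a bounded antitone
function: the Laplace transform at `0` governs the decay at `∞`. The rescaled measures with density
`s ^ (-α) G (x / s) exp (-x)` converge weakly as `s → 0`, because their Laplace transforms do; local
averages of the rescaled functions therefore converge, and monotonicity passes from averages to
values at `x = 1`. -/
theorem tendsto_rpow_mul_of_laplace {G : ℝ → ℝ} (hG : Antitone G) (hG0 : ∀ x, 0 ≤ G x)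
    (hG1 : ∀ x, G x ≤ 1) {α c : ℝ} (hα0 : 0 < α) (hα1 : α < 1)
    (hL : Tendsto (fun s : ℝ => s ^ (1 - α) * ∫ x in Set.Ioi 0, Real.exp (-(s * x)) * G x)
      (𝓝[>] 0) (𝓝 c)) :
    Tendsto (fun x : ℝ => x ^ α * G x) atTop (𝓝 (c / Real.Gamma (1 - α))) := by
  have hGm : Measurable G := hG.measurable
  have hΓ : 0 < Real.Gamma (1 - α) := Real.Gamma_pos_of_pos (by linarith)
  have hc : 0 ≤ c := by
    refine ge_of_tendsto hL ?_
    filter_upwards [self_mem_nhdsWithin] with s hs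
    exact mul_nonneg (Real.rpow_nonneg (le_of_lt hs) _)
      (integral_nonneg fun x => mul_nonneg (Real.exp_pos _).le (hG0 x))
  set C : ℝ := c / Real.Gamma (1 - α) with hC
  have hC0 : 0 ≤ C := div_nonneg hc hΓ.le
  -- the rescaled functions and their limit, with an exponential weight; the absolute value keeps
  -- them nonnegative for `s ≤ 0`, where they are not used
  set w : ℝ → ℝ → ℝ := fun s x => |s| ^ (-α) * G (x / s) with hw
  set w₀ : ℝ → ℝ := fun x => C * x ^ (-α) with hw₀
  have hwm : ∀ s, Measurable (w s) := fun s => by fun_prop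
  have hw₀m : Measurable w₀ := by fun_prop
  set h : ℝ → ℝ → ℝ := fun s x => w s x * Real.exp (-x) with hh
  set h₀ : ℝ → ℝ := fun x => w₀ x * Real.exp (-x) with hh₀
  have hhm : ∀ s, Measurable (h s) := fun s => by fun_prop
  have hh₀m : Measurable h₀ := by fun_prop
  have hh0 : ∀ s x, 0 < x → 0 ≤ h s x := fun s x _ =>
    mul_nonneg (mul_nonneg (Real.rpow_nonneg (abs_nonneg _) _) (hG0 _)) (Real.exp_pos _).le
  have hh₀0 : ∀ x, 0 < x → 0 ≤ h₀ x := fun x hx =>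
    mul_nonneg (mul_nonneg hC0 (Real.rpow_nonneg hx.le _)) (Real.exp_pos _).le
  have hhi : ∀ s, IntegrableOn (h s) (Set.Ioi 0) := by
    intro s
    refine Integrable.bdd_mul (c := |s| ^ (-α)) (integrableOn_exp_neg_Ioi 0) (by fun_prop)
      (ae_of_all _ fun x => ?_)
    rw [Real.norm_of_nonneg (mul_nonneg (Real.rpow_nonneg (abs_nonneg _) _) (hG0 _))]
    exact mul_le_of_le_one_right (Real.rpow_nonneg (abs_nonneg _) _) (hG1 _)
  have hh₀i : IntegrableOn h₀ (Set.Ioi 0) := by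
    have := (Real.GammaIntegral_convergent (show 0 < 1 - α by linarith)).const_mul C
    refine IntegrableOn.congr_fun this (fun x _ => ?_) measurableSet_Ioi
    simp only [hh₀, hw₀]
    rw [show 1 - α - 1 = -α by ring]
    ring
  have := fun s => isFiniteMeasure_halfLineMeasure (hhi s)
  have := isFiniteMeasure_halfLineMeasure hh₀i
  have hmom : ∀ k : ℕ, Tendsto
      (fun s => ∫ x, Real.exp (-(k * x)) ∂(halfLineMeasure (h s))) (𝓝[>] 0)
      (𝓝 (∫ x, Real.exp (-(k * x)) ∂(halfLineMeasure h₀))) := by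
    intro k
    have hk : (0 : ℝ) < k + 1 := by positivity
    have e0 : ∫ x, Real.exp (-(k * x)) ∂(halfLineMeasure h₀) = ((k : ℝ) + 1) ^ (α - 1) * c := by
      rw [integral_halfLineMeasure hh₀m hh₀0]
      have h1 := Real.integral_rpow_mul_exp_neg_mul_Ioi (show 0 < 1 - α by linarith) hk
      have h2 : ∫ x in Set.Ioi (0 : ℝ), h₀ x * Real.exp (-(k * x)) =
          ∫ x in Set.Ioi (0 : ℝ), C * (x ^ (1 - α - 1) * Real.exp (-(((k : ℝ) + 1) * x))) := by
        congr 1 with x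
        simp only [hh₀, hw₀]
        rw [mul_assoc, mul_assoc, ← Real.exp_add]
        ring_nf
      rw [h2, integral_const_mul, h1, one_div, Real.inv_rpow hk.le, ← Real.rpow_neg hk.le, hC]
      field_simp
      rw [neg_sub]
    rw [e0]
    have hscale : Tendsto (fun s : ℝ => ((k : ℝ) + 1) * s) (𝓝[>] 0) (𝓝[>] 0) := by
      refine tendsto_nhdsWithin_iff.2 ⟨?_, ?_⟩
      · have : Tendsto (fun s : ℝ => ((k : ℝ) + 1) * s) (𝓝 0) (𝓝 (((k : ℝ) + 1) * 0)) :=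
          tendsto_id.const_mul _
        rw [mul_zero] at this
        exact this.mono_left nhdsWithin_le_nhds
      · filter_upwards [self_mem_nhdsWithin] with s hs
        exact mul_pos hk hs
    refine ((hL.comp hscale).const_mul (((k : ℝ) + 1) ^ (α - 1))).congr' ?_
    filter_upwards [self_mem_nhdsWithin] with s hs
    have hs0 : (0 : ℝ) < s := hs
    rw [integral_halfLineMeasure (hhm s) (hh0 s)]
    have h3 := integral_comp_mul_left_Ioi
      (fun y => s ^ (-α) * (Real.exp (-(((k : ℝ) + 1) * s * y)) * G y)) 0 (inv_pos.2 hs0)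
    have h4 : ∫ x in Set.Ioi (0 : ℝ), h s x * Real.exp (-(k * x)) =
        ∫ x in Set.Ioi (0 : ℝ), s ^ (-α) *
          (Real.exp (-(((k : ℝ) + 1) * s * (s⁻¹ * x))) * G (s⁻¹ * x)) := by
      congr 1 with x
      simp only [hh, hw]
      rw [abs_of_pos hs0, mul_assoc, ← Real.exp_add]
      have : -(((k : ℝ) + 1) * s * (s⁻¹ * x)) = -x + -(k * x) := by
        field_simp
        ring
      rw [this, inv_mul_eq_div]
      ring
    rw [h4, h3, integral_const_mul, mul_zero, inv_inv, smul_eq_mul]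
    simp only [Function.comp]
    rw [Real.mul_rpow hk.le hs0.le, ← mul_assoc, ← mul_assoc, ← Real.rpow_add hk, ← mul_assoc,
      show α - 1 + (1 - α) = 0 by ring, Real.rpow_zero, one_mul,
      show (1 - α) = 1 + -α by ring, Real.rpow_add hs0, Real.rpow_one]
  -- values at the ends of an interval are compared with averages over it
  have key : ∀ a b : ℝ, 0 < a → a < b → ∃ (J : ℝ → ℝ) (j : ℝ), Tendsto J (𝓝[>] 0) (𝓝 j) ∧
      (∀ s, 0 < s → w s b ≤ J s ∧ J s ≤ w s a) ∧ w₀ b ≤ j ∧ j ≤ w₀ a := by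
    intro a b ha hab
    have hH := integral_expBump_pos ha hab
    set H : ℝ := ∫ x in Set.Ioi 0, expBump a b (Real.exp (-x)) * Real.exp (-x) with hHdef
    have ht := tendsto_integral_comp_exp_neg (fun s => halfLineMeasure_Iio (h s))
      (halfLineMeasure_Iio h₀) hmom (continuous_expBump a b)
    rw [integral_halfLineMeasure hh₀m hh₀0] at ht
    simp_rw [fun s => integral_halfLineMeasure (hhm s) (hh0 s)] at ht
    refine ⟨_, _, ht.div_const H, fun s hs => ?_, ?_⟩
    · have hanti : AntitoneOn (w s) (Set.Ioi 0) := by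
        intro x _ y _ hxy
        exact mul_le_mul_of_nonneg_left (hG (div_le_div_of_nonneg_right hxy hs.le))
          (Real.rpow_nonneg (abs_nonneg _) _)
      obtain ⟨h1, h2⟩ := integral_expBump_mul_mem ha hab hanti (hwm s)
      exact ⟨(le_div_iff₀ hH).2 h1, (div_le_iff₀ hH).2 h2⟩
    · have hanti : AntitoneOn w₀ (Set.Ioi 0) := by
        intro x hx y hy hxy
        exact mul_le_mul_of_nonneg_left
          (Real.rpow_le_rpow_of_nonpos hx hxy (by linarith)) hC0
      obtain ⟨h1, h2⟩ := integral_expBump_mul_mem ha hab hanti hw₀m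
      exact ⟨(le_div_iff₀ hH).2 h1, (div_le_iff₀ hH).2 h2⟩
  have hw₀1 : Tendsto w₀ (𝓝 1) (𝓝 C) := by
    have : ContinuousAt w₀ 1 :=
      continuousAt_const.mul (Real.continuousAt_rpow_const 1 (-α) (Or.inl one_ne_zero))
    simpa [hw₀] using this.tendsto
  have hmain : Tendsto (fun s => w s 1) (𝓝[>] 0) (𝓝 C) := by
    refine tendsto_order.2 ⟨fun m hm => ?_, fun m hm => ?_⟩
    · have h1 := (hw₀1.mono_left (nhdsWithin_le_nhds (s := Set.Ioi 1))).eventually_const_lt hm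
      obtain ⟨b, hb, hb1⟩ := (h1.and self_mem_nhdsWithin).exists
      obtain ⟨J, j, hJ, hJw, hj1, hj2⟩ := key 1 b one_pos hb1
      filter_upwards [hJ.eventually_const_lt (hb.trans_le hj1), self_mem_nhdsWithin] with s hs hs0
      exact hs.trans_le (hJw s hs0).2
    · have h1 := (hw₀1.mono_left (nhdsWithin_le_nhds (s := Set.Iio 1))).eventually_lt_const hm
      obtain ⟨a, ⟨ham, ha1⟩, ha0⟩ := ((h1.and self_mem_nhdsWithin).and
        (nhdsWithin_le_nhds (lt_mem_nhds (zero_lt_one (α := ℝ))))).exists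
      obtain ⟨J, j, hJ, hJw, hj1, hj2⟩ := key a 1 ha0 ha1
      filter_upwards [hJ.eventually_lt_const (hj2.trans_lt ham), self_mem_nhdsWithin] with s hs hs0
      exact (hJw s hs0).1.trans_lt hs
  refine (hmain.comp tendsto_inv_atTop_nhdsGT_zero).congr' ?_
  filter_upwards [eventually_gt_atTop 0] with x hx
  simp only [Function.comp, hw]
  rw [abs_of_pos (inv_pos.2 hx), Real.rpow_neg (inv_pos.2 hx).le, Real.inv_rpow hx.le, inv_inv,
    one_div, inv_inv]

/-- The Laplace transform of the tail of a law on `[0, ∞)`. -/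
lemma integral_exp_mul_tail {m : Measure ℝ} [IsProbabilityMeasure m] (hm : m (Set.Iio 0) = 0)
    {s : ℝ} (hs : 0 < s) :
    ∫ x in Set.Ioi 0, Real.exp (-(s * x)) * m.real (Set.Ioi x) =
      (1 - ∫ y, Real.exp (-(s * y)) ∂m) / s := by
  have hae := ae_nonneg_of_Iio hm
  set F : ℝ → ℝ → ℝ := fun x y => (Set.Ioi x).indicator (fun _ => Real.exp (-(s * x))) y with hF
  have hset : MeasurableSet {p : ℝ × ℝ | p.1 < p.2} := measurableSet_lt measurable_fst measurable_snd
  have hFe : Function.uncurry F =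
      {p : ℝ × ℝ | p.1 < p.2}.indicator fun p => Real.exp (-(s * p.1)) := by
    ext p
    rfl
  have hexp : IntegrableOn (fun x : ℝ => Real.exp (-(s * x))) (Set.Ioi 0) := by
    simpa using integrableOn_exp_mul_Ioi (show -s < 0 by linarith) 0
  have hint : Integrable (Function.uncurry F) ((volume.restrict (Set.Ioi 0)).prod m) := by
    rw [hFe]
    exact (hexp.comp_fst m).indicator hset
  have hswap := integral_integral_swap hint
  have e1 : ∀ x, ∫ y, F x y ∂m = Real.exp (-(s * x)) * m.real (Set.Ioi x) := by
    intro x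
    simp only [hF]
    rw [integral_indicator measurableSet_Ioi, setIntegral_const, smul_eq_mul, mul_comm]
  have e2 : ∀ y, 0 ≤ y → ∫ x in Set.Ioi 0, F x y = (1 - Real.exp (-(s * y))) / s := by
    intro y hy
    have h1 : ∀ x, F x y = (Set.Iio y).indicator (fun x => Real.exp (-(s * x))) x := fun x => rfl
    simp_rw [h1]
    rw [setIntegral_indicator measurableSet_Iio, Set.Ioi_inter_Iio,
      ← integral_Ioc_eq_integral_Ioo, ← intervalIntegral.integral_of_le hy]
    have h2 : ∀ x ∈ Set.uIcc 0 y,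
        HasDerivAt (fun x => -Real.exp (-(s * x)) / s) (Real.exp (-(s * x))) x := by
      intro x _
      have := ((((hasDerivAt_id' x).const_mul s).neg).exp.neg).div_const s
      refine this.congr_deriv ?_
      field_simp
      rfl
    rw [intervalIntegral.integral_eq_sub_of_hasDerivAt h2
      (Continuous.intervalIntegrable (by fun_prop) _ _)]
    simp only [mul_zero, neg_zero, Real.exp_zero]
    ring
  simp_rw [e1] at hswap
  rw [hswap, integral_congr_ae (hae.mono fun y hy => e2 y hy), integral_div, integral_sub
    (integrable_const _) ?_]
  · simp
  · refine Integrable.of_bound (by fun_prop) 1 ?_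
    filter_upwards [hae] with y hy
    rw [Real.norm_eq_abs, Real.abs_exp, Real.exp_le_one_iff]
    nlinarith

/-- A law on `[0, ∞)` whose Laplace transform is `1 - c s ^ α + o(s ^ α)` at `0` has the tail
`c x ^ (-α) / Γ (1 - α)`. -/
theorem tendsto_rpow_mul_tail {m : Measure ℝ} [IsProbabilityMeasure m] (hm : m (Set.Iio 0) = 0)
    {α c : ℝ} (hα0 : 0 < α) (hα1 : α < 1)
    (hL : Tendsto (fun s : ℝ => (1 - ∫ y, Real.exp (-(s * y)) ∂m) / s ^ α) (𝓝[>] 0) (𝓝 c)) :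
    Tendsto (fun x : ℝ => x ^ α * m.real (Set.Ioi x)) atTop (𝓝 (c / Real.Gamma (1 - α))) := by
  refine tendsto_rpow_mul_of_laplace
    (fun x y hxy => measureReal_mono (Set.Ioi_subset_Ioi hxy))
    (fun x => measureReal_nonneg) (fun x => measureReal_le_one) hα0 hα1 (hL.congr' ?_)
  filter_upwards [self_mem_nhdsWithin] with s hs
  have hs0 : (0 : ℝ) < s := hs
  rw [integral_exp_mul_tail hm hs0, Real.rpow_sub hs0, Real.rpow_one]
  have := Real.rpow_pos_of_pos hs0 α
  field_simp

end Tauberian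

/-! ### The continuity theorem for Laplace transforms and one-sided stable laws -/

section Stable

lemma integrable_exp_neg_mul_of_Iio {m : Measure ℝ} [IsFiniteMeasure m]
    (hm : m (Set.Iio 0) = 0) {s : ℝ} (hs : 0 ≤ s) :
    Integrable (fun x => Real.exp (-(s * x))) m := by
  refine Integrable.of_bound (by fun_prop) 1 ?_
  filter_upwards [ae_nonneg_of_Iio hm] with y hy
  rw [Real.norm_eq_abs, Real.abs_exp, Real.exp_le_one_iff]
  nlinarith

/-- Markov's inequality for `1 - exp (-x / r)`. -/
lemma measure_norm_gt_le_laplace {m : Measure ℝ} [IsProbabilityMeasure m]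
    (hm : m (Set.Iio 0) = 0) {r : ℝ} (hr : 0 < r) :
    m {x | r < ‖x‖} ≤
      ENNReal.ofReal ((1 - ∫ x, Real.exp (-(r⁻¹ * x)) ∂m) / (1 - Real.exp (-1))) := by
  have hd : 0 < 1 - Real.exp (-1) := by
    rw [sub_pos, Real.exp_lt_one_iff]
    norm_num
  have hi := integrable_exp_neg_mul_of_Iio hm (inv_pos.2 hr).le
  have hnn : 0 ≤ᵐ[m] fun x => 1 - Real.exp (-(r⁻¹ * x)) := by
    filter_upwards [ae_nonneg_of_Iio hm] with x hx
    simp only [Pi.zero_apply, sub_nonneg, Real.exp_le_one_iff]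
    have := mul_nonneg (inv_pos.2 hr).le hx
    linarith
  have hmarkov := mul_meas_ge_le_integral_of_nonneg hnn ((integrable_const 1).sub hi)
    (1 - Real.exp (-1))
  have hint : ∫ x, (1 - Real.exp (-(r⁻¹ * x))) ∂m = 1 - ∫ x, Real.exp (-(r⁻¹ * x)) ∂m := by
    rw [integral_sub (integrable_const 1) hi]
    simp
  rw [hint, mul_comm, ← le_div_iff₀ hd] at hmarkov
  rw [← ofReal_measureReal]
  refine ENNReal.ofReal_le_ofReal (le_trans ?_ hmarkov)
  have hsub : ∀ᵐ x ∂m, x ∈ {x : ℝ | r < ‖x‖} →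
      x ∈ {x | 1 - Real.exp (-1) ≤ 1 - Real.exp (-(r⁻¹ * x))} := by
    filter_upwards [ae_nonneg_of_Iio hm] with x hx hxr
    simp only [Real.norm_of_nonneg hx] at hxr ⊢
    have : 1 ≤ r⁻¹ * x := by
      rw [← div_eq_inv_mul, one_le_div hr]
      exact hxr.le
    have := Real.exp_le_exp.2 (show -(r⁻¹ * x) ≤ -1 by linarith)
    linarith
  exact ENNReal.toReal_mono (measure_ne_top _ _) (measure_mono_ae hsub)

/-- The **continuity theorem** for Laplace transforms of laws on `[0, ∞)`. The limit law is a
cluster point, by Prokhorov's theorem, and is unique, by uniqueness of Laplace transforms. -/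
theorem exists_tendsto_of_tendsto_laplace {M : ℕ → ProbabilityMeasure ℝ}
    (hM : ∀ n, (M n : Measure ℝ) (Set.Iio 0) = 0) {ψ : ℝ → ℝ}
    (hψ : ∀ s, 0 ≤ s → Tendsto (fun n => ∫ x, Real.exp (-(s * x)) ∂(M n : Measure ℝ)) atTop
      (𝓝 (ψ s))) (hψ0 : Tendsto ψ (𝓝[>] 0) (𝓝 1)) :
    ∃ L : ProbabilityMeasure ℝ, (L : Measure ℝ) (Set.Iio 0) = 0 ∧
      (∀ s, 0 ≤ s → ∫ x, Real.exp (-(s * x)) ∂(L : Measure ℝ) = ψ s) ∧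
      Tendsto M atTop (𝓝 L) := by
  have htight : IsTightMeasureSet (Set.range fun n => (M n : Measure ℝ)) := by
    refine isTightMeasureSet_range_of_tendsto_limsup_measure_norm_gt ?_
    have hup : Tendsto (fun r : ℝ => ENNReal.ofReal ((1 - ψ r⁻¹) / (1 - Real.exp (-1)))) atTop
        (𝓝 0) := by
      have h1 := ((hψ0.comp tendsto_inv_atTop_nhdsGT_zero).const_sub 1).div_const
        (1 - Real.exp (-1))
      rw [sub_self, zero_div] at h1
      simpa using ENNReal.tendsto_ofReal h1
    refine tendsto_of_tendsto_of_tendsto_of_le_of_le' tendsto_const_nhds hup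
      (Eventually.of_forall fun _ => zero_le) ?_
    filter_upwards [eventually_gt_atTop 0] with r hr
    have h2 : Tendsto (fun n => ENNReal.ofReal
        ((1 - ∫ x, Real.exp (-(r⁻¹ * x)) ∂(M n : Measure ℝ)) / (1 - Real.exp (-1)))) atTop
        (𝓝 (ENNReal.ofReal ((1 - ψ r⁻¹) / (1 - Real.exp (-1))))) :=
      ENNReal.tendsto_ofReal (((hψ _ (inv_pos.2 hr).le).const_sub 1).div_const _)
    rw [← h2.limsup_eq]
    exact limsup_le_limsup (Eventually.of_forall fun n => measure_norm_gt_le_laplace (hM n) hr)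
  have hcomp : IsCompact (closure (Set.range M)) := by
    refine isCompact_closure_of_isTightMeasureSet ?_
    convert htight using 1
    ext ρ
    simp
  -- every ultrafilter has a limit law with Laplace transform `ψ`
  have hultra : ∀ U : Ultrafilter ℕ, (U : Filter ℕ) ≤ atTop → ∃ L : ProbabilityMeasure ℝ,
      (L : Measure ℝ) (Set.Iio 0) = 0 ∧
      (∀ s, 0 ≤ s → ∫ x, Real.exp (-(s * x)) ∂(L : Measure ℝ) = ψ s) ∧ Tendsto M U (𝓝 L) := by
    intro U hU
    obtain ⟨L, -, hL⟩ := hcomp.ultrafilter_le_nhds (U.map M) (by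
      rw [le_principal_iff]
      exact mem_of_superset (Filter.range_mem_map) subset_closure)
    have hL' : Tendsto M U (𝓝 L) := hL
    have hL0 : (L : Measure ℝ) (Set.Iio 0) = 0 := by
      have := ProbabilityMeasure.le_liminf_measure_open_of_tendsto hL' isOpen_Iio (G := Set.Iio 0)
      simpa [hM] using this
    refine ⟨L, hL0, fun s hs => ?_, hL'⟩
    -- `exp (-s x)` is unbounded on the negative half-line, which carries no mass
    let f : ℝ →ᵇ ℝ := BoundedContinuousFunction.ofNormedAddCommGroup
      (fun x => Real.exp (-(s * max x 0))) (by fun_prop) 1 (fun x => by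
        rw [Real.norm_eq_abs, Real.abs_exp, Real.exp_le_one_iff]
        nlinarith [le_max_right x 0])
    have hf : ∀ τ : Measure ℝ, τ (Set.Iio 0) = 0 →
        ∫ x, f x ∂τ = ∫ x, Real.exp (-(s * x)) ∂τ := by
      intro τ hτ
      refine integral_congr_ae ?_
      filter_upwards [ae_nonneg_of_Iio hτ] with x hx
      simp [f, max_eq_left hx]
    have h1 := ProbabilityMeasure.tendsto_iff_forall_integral_tendsto.1 hL' f
    rw [hf _ hL0] at h1
    simp_rw [fun n => hf _ (hM n)] at h1
    exact tendsto_nhds_unique h1 ((hψ s hs).mono_left hU)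
  obtain ⟨L, hL0, hLψ, -⟩ := hultra (Ultrafilter.of atTop) (Ultrafilter.of_le atTop)
  refine ⟨L, hL0, hLψ, (tendsto_iff_ultrafilter _ _ _).2 fun U hU => ?_⟩
  obtain ⟨L', hL0', hLψ', hL'⟩ := hultra U hU
  have : (L' : Measure ℝ) = L := eq_of_laplace_eq hL0' hL0 fun k => by
    rw [hLψ' _ (Nat.cast_nonneg k), hLψ _ (Nat.cast_nonneg k)]
  rwa [Subtype.ext this] at hL'

/-- The law on `[0, ∞)` with Laplace transform `exp (-c s ^ α)` is stable. It is not a point mass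
`δ_d`, whose Laplace transform `exp (-d s)` has a linear exponent. -/
lemma isStableLaw_of_laplace {L : Measure ℝ} [IsProbabilityMeasure L] (hL0 : L (Set.Iio 0) = 0)
    {α c : ℝ} (hα0 : 0 < α) (hα1 : α < 1) (hc : 0 < c)
    (hL : ∀ s, 0 ≤ s → ∫ x, Real.exp (-(s * x)) ∂L = Real.exp (-(c * s ^ α))) :
    IsStableLaw α L := by
  refine ⟨hα0, by linarith, inferInstance, fun d hd => ?_, fun a b ha hb => ⟨0, ?_⟩⟩
  · have h1 := hL 1 zero_le_one
    have h2 := hL 2 zero_le_two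
    rw [hd, integral_dirac, Real.exp_eq_exp] at h1 h2
    rw [Real.one_rpow] at h1
    have h3 : (2 : ℝ) ^ α < 2 := by
      simpa using Real.rpow_lt_rpow_of_exponent_lt (show (1 : ℝ) < 2 by norm_num) hα1
    nlinarith
  · have hae := ae_nonneg_of_Iio hL0
    have hσ : 0 ≤ (a ^ α + b ^ α) ^ (1 / α) := by positivity
    have hmass1 : (L.prod L).map (fun p : ℝ × ℝ => a * p.1 + b * p.2) (Set.Iio 0) = 0 := by
      rw [Measure.map_apply (by fun_prop) measurableSet_Iio]
      have : ∀ᵐ p ∂(L.prod L), 0 ≤ a * p.1 + b * p.2 := by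
        filter_upwards [Measure.quasiMeasurePreserving_fst.ae hae,
          Measure.quasiMeasurePreserving_snd.ae hae] with p h1 h2
        positivity
      simpa [ae_iff, Set.preimage, Set.Iio] using this
    have hmass2 : L.map (fun x : ℝ => (a ^ α + b ^ α) ^ (1 / α) * x + 0) (Set.Iio 0) = 0 := by
      rw [Measure.map_apply (by fun_prop) measurableSet_Iio]
      have : ∀ᵐ x ∂L, 0 ≤ (a ^ α + b ^ α) ^ (1 / α) * x + 0 := by
        filter_upwards [hae] with x hx
        positivity
      simpa [ae_iff, Set.preimage, Set.Iio] using this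
    have := Measure.isProbabilityMeasure_map (μ := L.prod L)
      (f := fun p : ℝ × ℝ => a * p.1 + b * p.2) (by fun_prop)
    have := Measure.isProbabilityMeasure_map (μ := L)
      (f := fun x : ℝ => (a ^ α + b ^ α) ^ (1 / α) * x + 0) (by fun_prop)
    refine eq_of_laplace_eq hmass1 hmass2 fun k => ?_
    have hk : (0 : ℝ) ≤ k := Nat.cast_nonneg k
    rw [integral_map (by fun_prop) (by fun_prop), integral_map (by fun_prop) (by fun_prop)]
    have e1 : ∫ p : ℝ × ℝ, Real.exp (-(k * (a * p.1 + b * p.2))) ∂(L.prod L) =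
        (∫ x, Real.exp (-(k * a * x)) ∂L) * ∫ x, Real.exp (-(k * b * x)) ∂L := by
      rw [← integral_prod_mul]
      congr 1 with p
      rw [← Real.exp_add]
      ring_nf
    have e2 : ∫ x, Real.exp (-(k * ((a ^ α + b ^ α) ^ (1 / α) * x + 0))) ∂L =
        ∫ x, Real.exp (-(k * (a ^ α + b ^ α) ^ (1 / α) * x)) ∂L := by
      congr 1 with x
      ring_nf
    rw [e1, e2, hL _ (by positivity), hL _ (by positivity), hL _ (by positivity), ← Real.exp_add,
      Real.mul_rpow hk ha.le, Real.mul_rpow hk hb.le, Real.mul_rpow hk hσ,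
      ← Real.rpow_mul (by positivity), one_div_mul_cancel hα0.ne', Real.rpow_one]
    ring_nf

lemma integral_exp_neg_sum (m : Measure ℝ) [IsProbabilityMeasure m] (n : ℕ) (s a : ℝ) :
    ∫ x : Fin n → ℝ, Real.exp (-(s * ((∑ i, x i) / a))) ∂(Measure.pi fun _ => m) =
      (∫ y, Real.exp (-(s / a * y)) ∂m) ^ n := by
  have := integral_fintype_prod_eq_pow (ι := Fin n) (fun y => Real.exp (-(s / a * y))) (μ := m)
  rw [Fintype.card_fin] at this
  rw [← this]
  congr 1 with x
  rw [← Real.exp_sum]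
  congr 1
  rw [Finset.sum_neg_distrib, ← Finset.mul_sum]
  ring

/-- A law on `[0, ∞)` whose Laplace transform is `1 - c s ^ α + o(s ^ α)` at `0` is in the domain
of attraction of the one-sided `α`-stable law. -/
theorem inStableDomain_of_laplace {m : Measure ℝ} [IsProbabilityMeasure m]
    (hm : m (Set.Iio 0) = 0) {α c : ℝ} (hα0 : 0 < α) (hα1 : α < 1) (hc : 0 < c)
    (hL : Tendsto (fun s : ℝ => (1 - ∫ y, Real.exp (-(s * y)) ∂m) / s ^ α) (𝓝[>] 0) (𝓝 c)) :
    InStableDomain α m := by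
  -- the usual norming `n ^ (1 / α)`, shifted in order to be positive at `n = 0`
  set a : ℕ → ℝ := fun n => ((n : ℝ) + 1) ^ (1 / α) with ha
  have ha0 : ∀ n, 0 < a n := fun n => by positivity
  have hSm : ∀ n, Measurable fun x : Fin n → ℝ => (∑ i, x i) / a n := fun n => by fun_prop
  let M : ℕ → ProbabilityMeasure ℝ := fun n =>
    ⟨(Measure.pi fun _ : Fin n => m).map fun x => (∑ i, x i) / a n,
      Measure.isProbabilityMeasure_map (hSm n).aemeasurable⟩
  have hMdef : ∀ n, (M n : Measure ℝ) =
    (Measure.pi fun _ : Fin n => m).map fun x => (∑ i, x i) / a n := fun n => rfl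
  have hM0 : ∀ n, (M n : Measure ℝ) (Set.Iio 0) = 0 := by
    intro n
    rw [hMdef, Measure.map_apply (hSm n) measurableSet_Iio]
    have hx : ∀ᵐ x ∂(Measure.pi fun _ : Fin n => m), ∀ i, 0 ≤ x i := by
      rw [ae_all_iff]
      intro i
      exact (measurePreserving_eval (fun _ : Fin n => m) i).quasiMeasurePreserving.ae
        (ae_nonneg_of_Iio hm)
    have : ∀ᵐ x ∂(Measure.pi fun _ : Fin n => m), 0 ≤ (∑ i, x i) / a n := by
      filter_upwards [hx] with x hx
      exact div_nonneg (Finset.sum_nonneg fun i _ => hx i) (ha0 n).le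
    simpa [ae_iff, Set.preimage, Set.Iio] using this
  have hMlap : ∀ s, 0 ≤ s → Tendsto (fun n => ∫ x, Real.exp (-(s * x)) ∂(M n : Measure ℝ)) atTop
      (𝓝 (Real.exp (-(c * s ^ α)))) := by
    intro s hs
    have hval : ∀ n, ∫ x, Real.exp (-(s * x)) ∂(M n : Measure ℝ) =
        (1 + ((∫ y, Real.exp (-(s / a n * y)) ∂m) - 1)) ^ n := by
      intro n
      rw [hMdef, integral_map (hSm n).aemeasurable (by fun_prop), integral_exp_neg_sum]
      ring
    simp_rw [hval]
    rcases hs.eq_or_lt with rfl | hs0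
    · simp [Real.zero_rpow hα0.ne']
    refine Real.tendsto_one_add_pow_exp_of_tendsto ?_
    have hscale : Tendsto (fun n => s / a n) atTop (𝓝[>] 0) := by
      refine tendsto_nhdsWithin_iff.2 ⟨?_, Eventually.of_forall fun n => div_pos hs0 (ha0 n)⟩
      refine Tendsto.div_atTop tendsto_const_nhds ?_
      exact (tendsto_rpow_atTop (by positivity)).comp
        (tendsto_atTop_add_const_right _ 1 tendsto_natCast_atTop_atTop)
    have h1 := hL.comp hscale
    have h2 : Tendsto (fun n : ℕ => (n : ℝ) / (n + 1)) atTop (𝓝 1) :=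
      tendsto_natCast_div_add_atTop 1
    have h3 := (((h1.mul h2).mul_const (s ^ α)).neg)
    rw [mul_one] at h3
    refine h3.congr fun n => ?_
    simp only [Function.comp]
    have hn : (0 : ℝ) < (n : ℝ) + 1 := by positivity
    rw [Real.div_rpow hs0.le (ha0 n).le]
    have han : a n ^ α = (n : ℝ) + 1 := by
      simp only [ha]
      rw [← Real.rpow_mul hn.le, one_div_mul_cancel hα0.ne', Real.rpow_one]
    rw [han]
    have := Real.rpow_pos_of_pos hs0 α
    field_simp
    ring
  have hψ0 : Tendsto (fun s : ℝ => Real.exp (-(c * s ^ α))) (𝓝[>] 0) (𝓝 1) := by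
    have h1 : Continuous fun s : ℝ => Real.exp (-(c * s ^ α)) :=
      Real.continuous_exp.comp ((continuous_const.mul (Real.continuous_rpow_const hα0.le)).neg)
    have h2 := h1.tendsto 0
    simp only [Real.zero_rpow hα0.ne', mul_zero, neg_zero, Real.exp_zero] at h2
    exact h2.mono_left nhdsWithin_le_nhds
  obtain ⟨L, hL0, hLψ, hLt⟩ := exists_tendsto_of_tendsto_laplace hM0 hMlap hψ0
  refine ⟨inferInstance, L, isStableLaw_of_laplace hL0 hα0 hα1 hc hLψ, a, fun _ => 0, ha0,
    fun f => ?_⟩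
  have := ProbabilityMeasure.tendsto_iff_forall_integral_tendsto.1 hLt f
  refine this.congr fun n => ?_
  rw [hMdef, integral_map (hSm n).aemeasurable (by fun_prop)]
  simp

end Stable

/-! ### The Laplace transform of the first-ladder height at the origin -/

/-- An expansion `φ s = 1 - ν s ^ β + o(s ^ β)` of a characteristic function determines
`log (1 - Re φ s)` up to a vanishing error. -/
lemma tendsto_log_one_sub_re_sub_log {φ : ℝ → ℂ} {β ν : ℝ} (hν : 0 < ν)
    (hφ : (fun s : ℝ => φ s - ((1 - ν * s ^ β : ℝ) : ℂ)) =o[𝓝[>] (0 : ℝ)] fun s : ℝ => s ^ β) :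
    Tendsto (fun s => Real.log (1 - (φ s).re) - Real.log (ν * s ^ β)) (𝓝[>] 0) (𝓝 0) := by
  have h1 : (fun s : ℝ => (φ s).re - (1 - ν * s ^ β)) =o[𝓝[>] (0 : ℝ)] fun s : ℝ => s ^ β := by
    refine IsBigO.trans_isLittleO (isBigO_of_le _ fun s => ?_) hφ
    have := Complex.abs_re_le_norm (φ s - ((1 - ν * s ^ β : ℝ) : ℂ))
    rwa [Complex.sub_re, Complex.ofReal_re] at this
  have h2 : Tendsto (fun s : ℝ => (1 - (φ s).re) / (ν * s ^ β)) (𝓝[>] 0) (𝓝 1) := by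
    have h := (h1.tendsto_div_nhds_zero.div_const ν).const_sub 1
    rw [zero_div, sub_zero] at h
    refine h.congr' ?_
    filter_upwards [self_mem_nhdsWithin] with s hs
    have : 0 < s ^ β := Real.rpow_pos_of_pos hs β
    field_simp
    ring
  have h3 := (Real.continuousAt_log one_ne_zero).tendsto.comp h2
  rw [Real.log_one] at h3
  refine h3.congr' ?_
  filter_upwards [self_mem_nhdsWithin, h2.eventually_ne one_ne_zero] with s hs hne
  have : 0 < s ^ β := Real.rpow_pos_of_pos hs β
  have hne' : 1 - (φ s).re ≠ 0 := fun h => hne (by rw [h, zero_div])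
  rw [Function.comp, Real.log_div hne' (by positivity)]

section Ladder

variable {Ω : Type*} [MeasurableSpace Ω] {μ : Measure Ω} [IsProbabilityMeasure μ] {ξ : ℕ → Ω → ℝ}

/-- A symmetric increment whose characteristic function is not constantly `1` is positive with
positive probability. -/
lemma measure_pos_of_symmetric (hsymm : IdentDistrib (fun ω => -ξ 0 ω) (ξ 0) μ μ) {β ν : ℝ}
    (hν : 0 < ν)
    (hφ : (fun s : ℝ => charFun (μ.map (ξ 0)) s - ((1 - ν * s ^ β : ℝ) : ℂ))
      =o[𝓝[>] (0 : ℝ)] fun s : ℝ => s ^ β) :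
    0 < μ {ω | 0 < ξ 0 ω} := by
  rw [pos_iff_ne_zero]
  intro h0
  have h1 : ∀ᵐ ω ∂μ, ξ 0 ω ≤ 0 := by
    rw [ae_iff]
    simpa using h0
  have h2 : ∀ᵐ ω ∂μ, -ξ 0 ω ≤ 0 := hsymm.symm.ae_snd (p := fun x => x ≤ 0) measurableSet_Iic h1
  have h3 : ξ 0 =ᵐ[μ] fun _ => 0 := by
    filter_upwards [h1, h2] with ω a b
    linarith
  have h4 : ∀ s, charFun (μ.map (ξ 0)) s = 1 := by
    intro s
    rw [Measure.map_congr h3, Measure.map_const]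
    simp
  have h5 : (fun s : ℝ => s ^ β) =o[𝓝[>] (0 : ℝ)] fun s : ℝ => s ^ β := by
    refine IsBigO.trans_isLittleO ?_ hφ
    refine IsBigO.of_bound ν⁻¹ (Eventually.of_forall fun s => ?_)
    rw [h4, show (1 : ℂ) - ((1 - ν * s ^ β : ℝ) : ℂ) = ((ν * s ^ β : ℝ) : ℂ) by push_cast; ring,
      Complex.norm_real, norm_mul, Real.norm_of_nonneg hν.le, inv_mul_cancel_left₀ hν.ne']
  refine absurd (isLittleO_irrefl' ?_ h5) not_false
  refine Eventually.frequently ?_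
  filter_upwards [self_mem_nhdsWithin] with s hs
  exact norm_ne_zero_iff.2 (Real.rpow_pos_of_pos hs β).ne'

/-- The asymptotic form `1 - 𝔼[exp (-r S_𝒯); 𝒯 < ∞] ∼ Φ(1, 0) √ν r ^ (β / 2)`: the Poisson
kernels concentrate at the origin as `r → 0`, so the Poisson integral of `log (1 - φ)` follows
`log (ν r ^ β)`. -/
lemma tendsto_one_sub_laplace_leapover_div (hmeas : ∀ k, Measurable (ξ k))
    (hindep : iIndepFun ξ μ) (hident : ∀ k, IdentDistrib (ξ k) (ξ 0) μ μ)
    (hsymm : IdentDistrib (fun ω => -ξ 0 ω) (ξ 0) μ μ) {β ν : ℝ} (hν : 0 < ν)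
    (hφ : (fun s : ℝ => charFun (μ.map (ξ 0)) s - ((1 - ν * s ^ β : ℝ) : ℂ))
      =o[𝓝[>] (0 : ℝ)] fun s : ℝ => s ^ β) :
    Tendsto (fun r => (1 - ∫ ω in ladderExists ξ, Real.exp (-r * leapover ξ ω) ∂μ) / r ^ (β / 2))
      (𝓝[>] 0) (𝓝 (walkPhi μ ξ * Real.sqrt ν)) := by
  have hpos := measure_pos_of_symmetric hsymm hν hφ
  have key := fun r hr => one_sub_laplace_leapover_eq (r := r) hmeas hindep hident hsymm hpos hr
  have h1 := tendsto_integral_poissonKer_mul_sub_log hν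
    (ψ := fun t => Real.log (1 - (charFun (μ.map (ξ 0)) t).re)) (fun r hr => (key r hr).1)
    (fun t => by rw [charFun_neg, Complex.conj_re]) (tendsto_log_one_sub_re_sub_log hν hφ)
  have h2 := ((Real.continuous_exp.tendsto _).comp (h1.const_mul (1 / 2))).const_mul
    (walkPhi μ ξ * Real.sqrt ν)
  rw [mul_zero, Real.exp_zero, mul_one] at h2
  refine h2.congr' ?_
  filter_upwards [self_mem_nhdsWithin] with r hr
  have hr0 : (0 : ℝ) < r := hr
  have hp : 0 < r ^ β := Real.rpow_pos_of_pos hr β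
  have h3 : Real.exp (1 / 2 * Real.log (ν * r ^ β)) = Real.sqrt ν * r ^ (β / 2) := by
    rw [mul_comm, ← Real.rpow_def_of_pos (by positivity), ← Real.sqrt_eq_rpow,
      Real.sqrt_mul hν.le, Real.sqrt_eq_rpow (r ^ β), ← Real.rpow_mul hr0.le]
    ring_nf
  rw [(key r hr).2, Function.comp, mul_sub, Real.exp_sub, h3]
  have := Real.rpow_pos_of_pos hr (β / 2)
  have := Real.sqrt_pos.2 hν
  field_simp

/-- The walk reaches the positive half-line almost surely, because
`ℙ(𝒯 = ∞) ≤ 1 - 𝔼[exp (-r S_𝒯); 𝒯 < ∞]` and the right side tends to `0` with `r`. -/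
lemma ae_mem_ladderExists (hmeas : ∀ k, Measurable (ξ k)) {α c : ℝ} (hα : 0 < α)
    (h : Tendsto
      (fun r => (1 - ∫ ω in ladderExists ξ, Real.exp (-r * leapover ξ ω) ∂μ) / r ^ α)
      (𝓝[>] 0) (𝓝 c)) :
    ∀ᵐ ω ∂μ, ω ∈ ladderExists ξ := by
  have h1 : Tendsto (fun r : ℝ => r ^ α) (𝓝[>] 0) (𝓝 0) := by
    have := (Real.continuousAt_rpow_const 0 α (Or.inr hα.le)).tendsto
    rw [Real.zero_rpow hα.ne'] at this
    exact this.mono_left nhdsWithin_le_nhds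
  have h2 : Tendsto (fun r => 1 - ∫ ω in ladderExists ξ, Real.exp (-r * leapover ξ ω) ∂μ)
      (𝓝[>] 0) (𝓝 0) := by
    have := h.mul h1
    rw [mul_zero] at this
    refine this.congr' ?_
    filter_upwards [self_mem_nhdsWithin] with r hr
    exact div_mul_cancel₀ _ (Real.rpow_pos_of_pos hr α).ne'
  have h3 : 1 - μ.real (ladderExists ξ) ≤ 0 := by
    refine ge_of_tendsto h2 ?_
    filter_upwards [self_mem_nhdsWithin] with r hr
    have hle : ∫ ω in ladderExists ξ, Real.exp (-r * leapover ξ ω) ∂μ ≤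
        ∫ ω in ladderExists ξ, (1 : ℝ) ∂μ := by
      refine integral_mono_of_nonneg (ae_of_all _ fun ω => (Real.exp_pos _).le)
        (integrable_const _) (ae_of_all _ fun ω => ?_)
      rw [Real.exp_le_one_iff]
      have := mul_nonneg (le_of_lt (Set.mem_Ioi.1 hr)) (leapover_nonneg (ξ := ξ) ω)
      linarith
    rw [setIntegral_const, smul_eq_mul, mul_one] at hle
    linarith
  have h4 : μ (ladderExists ξ) = 1 := by
    have : μ.real (ladderExists ξ) = 1 := le_antisymm measureReal_le_one (by linarith)
    rwa [measureReal_def, ENNReal.toReal_eq_one_iff] at this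
  exact (mem_ae_iff_prob_eq_one (measurableSet_ladderExists hmeas)).2 h4

end Ladder

/-! ### The constant for integer-valued and for atomless increments -/

lemma intervalIntegral_cos_mul_int (j : ℤ) :
    ∫ t in (0 : ℝ)..Real.pi, Real.cos (t * j) = if j = 0 then Real.pi else 0 := by
  split_ifs with h
  · simp [h]
  · have hj : (j : ℝ) ≠ 0 := by exact_mod_cast h
    rw [intervalIntegral.integral_comp_mul_right _ hj, integral_cos]
    simp [mul_comm Real.pi, Real.sin_int_mul_pi]

/-- Fourier inversion at the origin for a law on the integers. -/
lemma measureReal_singleton_zero_eq_integral_re_charFun (m : Measure ℝ) [IsProbabilityMeasure m]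
    (hm : ∀ᵐ x : ℝ ∂m, ∃ j : ℤ, x = j) :
    m.real {0} = ∫ t in Set.Ioc 0 Real.pi, Real.pi⁻¹ * (charFun m t).re := by
  have h1 : ∀ t, (charFun m t).re = ∫ x, Real.cos (t * x) ∂m := by
    intro t
    have hi : Integrable (fun x : ℝ => Complex.exp (t * x * Complex.I)) m := by
      refine Integrable.of_bound (by fun_prop) 1 (ae_of_all _ fun x => ?_)
      rw [← Complex.ofReal_mul, Complex.norm_exp_ofReal_mul_I]
    rw [charFun_apply_real]
    have h := integral_re hi
    simp only [RCLike.re_to_complex] at h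
    rw [← h]
    refine integral_congr_ae (ae_of_all _ fun x => ?_)
    simp only
    rw [← Complex.ofReal_mul, Complex.exp_ofReal_mul_I_re]
  simp_rw [h1]
  rw [integral_const_mul, integral_integral_swap]
  · have h2 : ∀ᵐ x ∂m, ∫ t in Set.Ioc 0 Real.pi, Real.cos (t * x) =
        Set.indicator {0} (fun _ => Real.pi) x := by
      filter_upwards [hm] with x hx
      obtain ⟨j, rfl⟩ := hx
      rw [← intervalIntegral.integral_of_le Real.pi_pos.le, intervalIntegral_cos_mul_int]
      simp [Set.indicator]
    rw [integral_congr_ae h2, integral_indicator (measurableSet_singleton 0), setIntegral_const,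
      smul_eq_mul]
    field_simp [Real.pi_pos.ne']
  · refine Integrable.of_bound (by fun_prop) 1 (ae_of_all _ fun p => ?_)
    exact Real.abs_cos_le_one _

section Constant

variable {Ω : Type*} [MeasurableSpace Ω] {μ : Measure Ω} [IsProbabilityMeasure μ] {ξ : ℕ → Ω → ℝ}

/-- For integer-valued increments `ℙ(S_n = 0)` is the mean of `φ ^ n` over `[0, π]`, so that the
logarithmic series of the probabilities sums to the mean of `-log (1 - φ)`. -/
lemma integrable_log_and_walkPhi_eq_latticePhi (hmeas : ∀ k, Measurable (ξ k))
    (hindep : iIndepFun ξ μ) (hident : ∀ k, IdentDistrib (ξ k) (ξ 0) μ μ)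
    (hsymm : IdentDistrib (fun ω => -ξ 0 ω) (ξ 0) μ μ) (hpos : 0 < μ {ω | 0 < ξ 0 ω})
    (hint : ∀ᵐ ω ∂μ, ∃ j : ℤ, ξ 0 ω = j) :
    IntervalIntegrable (fun t : ℝ => Real.log (1 - (charFun (μ.map (ξ 0)) t).re))
        volume 0 Real.pi ∧
      walkPhi μ ξ = latticePhi (μ.map (ξ 0)) 1 := by
  have hZ : MeasurableSet {x : ℝ | ∃ j : ℤ, x = j} :=
    (Set.countable_range fun j : ℤ => (j : ℝ)).measurableSet.congr (by ext x; simp [eq_comm])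
  have hall : ∀ᵐ ω ∂μ, ∀ k, ∃ j : ℤ, ξ k ω = j :=
    ae_all_iff.2 fun k => (hident k).symm.ae_snd (p := fun x => ∃ j : ℤ, x = j) hZ hint
  have hwalk : ∀ n, ∀ᵐ x : ℝ ∂(μ.map (walk ξ n)), ∃ j : ℤ, x = j := by
    intro n
    rw [ae_map_iff (measurable_walk hmeas n).aemeasurable hZ]
    filter_upwards [hall] with ω hω
    choose j hj using hω
    exact ⟨∑ k ∈ Finset.range n, j k, by simp [walk, hj]⟩
  have ha : ∀ n : ℕ, μ.real {ω | walk ξ (n + 1) ω = 0} =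
      ∫ t in Set.Ioc 0 Real.pi, Real.pi⁻¹ * (charFun (μ.map (ξ 0)) t).re ^ (n + 1) := by
    intro n
    have hw := measurable_walk hmeas (n + 1)
    have := Measure.isProbabilityMeasure_map (μ := μ) hw.aemeasurable
    have h := measureReal_singleton_zero_eq_integral_re_charFun _ (hwalk (n + 1))
    rw [map_measureReal_apply hw (measurableSet_singleton 0)] at h
    refine Eq.trans h (integral_congr_ae (ae_of_all _ fun t => ?_))
    simp only
    rw [charFun_map_walk hmeas hindep hident, ← ofReal_re_charFun_of_symmetric hmeas hsymm,
      ← Complex.ofReal_pow, Complex.ofReal_re, Complex.ofReal_re]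
  have := Measure.isProbabilityMeasure_map (μ := μ) (hmeas 0).aemeasurable
  obtain ⟨h1, h2⟩ := integrable_log_one_sub_and_tsum
    (κ := volume.restrict (Set.Ioc 0 Real.pi)) (k := fun _ => Real.pi⁻¹)
    (φ := fun t => (charFun (μ.map (ξ 0)) t).re) (fun _ => inv_pos.2 Real.pi_pos)
    measurable_const (integrable_const _) (by fun_prop)
    (fun t => abs_re_charFun_le_one _ t) ha (fun n => measureReal_nonneg)
    (summable_measureReal_walk_eq_zero hmeas hindep hident hpos)
  constructor
  · rw [intervalIntegrable_iff_integrableOn_Ioc_of_le Real.pi_pos.le]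
    have := h1.const_mul Real.pi
    refine this.congr (ae_of_all _ fun t => ?_)
    simp only
    rw [mul_inv_cancel_left₀ Real.pi_pos.ne']
  · rw [walkPhi, latticePhi, h2, integral_const_mul,
      intervalIntegral.integral_of_le Real.pi_pos.le]
    simp only [one_mul]
    congr 1
    field_simp

lemma walkPhi_eq_one_of_atomless (hmeas : ∀ k, Measurable (ξ k)) (hindep : iIndepFun ξ μ)
    (hident : ∀ k, IdentDistrib (ξ k) (ξ 0) μ μ) (hatom : ∀ c : ℝ, μ {ω | ξ 0 ω = c} = 0) :
    walkPhi μ ξ = 1 := by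
  have h0 : ∀ n : ℕ, μ.real {ω | walk ξ (n + 1) ω = 0} = 0 := by
    intro n
    have h1 := (indepFun_iff_map_prod_eq_prod_map_map (measurable_walk hmeas n).aemeasurable
      (hmeas n).aemeasurable).1 (indepFun_walk hmeas hindep n)
    have hS : MeasurableSet {p : ℝ × ℝ | p.1 + p.2 = 0} :=
      measurableSet_eq_fun (by fun_prop) measurable_const
    have h2 : {ω | walk ξ (n + 1) ω = 0} =
        (fun ω => (walk ξ n ω, ξ n ω)) ⁻¹' {p : ℝ × ℝ | p.1 + p.2 = 0} := by
      ext ω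
      simp [walk, Finset.sum_range_succ]
    rw [measureReal_def, h2, ← Measure.map_apply ((measurable_walk hmeas n).prodMk (hmeas n)) hS,
      h1, Measure.measure_prod_null hS |>.2, ENNReal.toReal_zero]
    refine ae_of_all _ fun x => ?_
    have h3 : Prod.mk x ⁻¹' {p : ℝ × ℝ | p.1 + p.2 = 0} = {-x} := by
      ext y
      simp [add_eq_zero_iff_neg_eq, eq_comm]
    simp only [Pi.zero_apply]
    rw [h3, (hident n).map_eq, Measure.map_apply (hmeas 0) (measurableSet_singleton _)]
    exact hatom (-x)
  simp [walkPhi, h0]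

end Constant

/-! ### Tail and domain of attraction of the first-ladder height -/

theorem mainTheorem11 {Ω : Type*} [MeasurableSpace Ω] (μ : Measure Ω) [IsProbabilityMeasure μ]
    (ξ : ℕ → Ω → ℝ) (hmeas : ∀ k, Measurable (ξ k))
    (hindep : iIndepFun ξ μ) (hident : ∀ k, IdentDistrib (ξ k) (ξ 0) μ μ)
    (hsymm : IdentDistrib (fun ω => -ξ 0 ω) (ξ 0) μ μ)
    (β ν : ℝ) (hβ0 : 0 < β) (hβ2 : β < 2) (hν : 0 < ν)
    (hφ : (fun s : ℝ => charFun (μ.map (ξ 0)) s - ((1 - ν * s ^ β : ℝ) : ℂ))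
      =o[𝓝[>] (0 : ℝ)] fun s : ℝ => s ^ β) :
    (∀ᵐ ω ∂μ, ∃ n : ℕ, 0 < n ∧ 0 < walk ξ n ω) ∧
    InStableDomain (β / 2) (μ.map (leapover ξ)) ∧
    (Summable (fun n : ℕ => μ.real {ω | walk ξ (n + 1) ω = 0} / (n + 1)) ∧
      (fun x : ℝ => μ.real {ω | x < leapover ξ ω}) ~[atTop]
        fun x : ℝ => Real.sqrt ν / Real.Gamma (1 - β / 2) * walkPhi μ ξ * x ^ (-(β / 2))) ∧
    ((∀ᵐ ω ∂μ, ∃ j : ℤ, ξ 0 ω = j) →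
      IntervalIntegrable (fun t : ℝ => Real.log (1 - (charFun (μ.map (ξ 0)) t).re))
        volume 0 Real.pi ∧
      (fun x : ℝ => μ.real {ω | x < leapover ξ ω}) ~[atTop]
        fun x : ℝ => Real.sqrt ν / Real.Gamma (1 - β / 2) * latticePhi (μ.map (ξ 0)) 1
          * x ^ (-(β / 2))) ∧
    ((∀ c : ℝ, μ {ω | ξ 0 ω = c} = 0) →
      (fun x : ℝ => μ.real {ω | x < leapover ξ ω}) ~[atTop]
        fun x : ℝ => Real.sqrt ν / Real.Gamma (1 - β / 2) * x ^ (-(β / 2))) := by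
  have hα0 : 0 < β / 2 := by linarith
  have hα1 : β / 2 < 1 := by linarith
  have hL := tendsto_one_sub_laplace_leapover_div hmeas hindep hident hsymm hν hφ
  have hae := ae_mem_ladderExists hmeas hα0 hL
  have hpos := measure_pos_of_symmetric hsymm hν hφ
  have hH := measurable_leapover hmeas
  have hc : 0 < walkPhi μ ξ * Real.sqrt ν := mul_pos (Real.exp_pos _) (Real.sqrt_pos.2 hν)
  have := Measure.isProbabilityMeasure_map (μ := μ) hH.aemeasurable
  have hm0 : μ.map (leapover ξ) (Set.Iio 0) = 0 := by
    rw [Measure.map_apply hH measurableSet_Iio]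
    convert measure_empty (μ := μ)
    ext ω
    simp [leapover_nonneg]
  have hL' : Tendsto (fun s => (1 - ∫ y, Real.exp (-(s * y)) ∂(μ.map (leapover ξ))) / s ^ (β / 2))
      (𝓝[>] 0) (𝓝 (walkPhi μ ξ * Real.sqrt ν)) := by
    refine hL.congr fun s => ?_
    rw [integral_map hH.aemeasurable (by fun_prop), Measure.restrict_eq_self_of_ae_mem hae]
    simp only [neg_mul]
  have htail : (fun x : ℝ => μ.real {ω | x < leapover ξ ω}) ~[atTop]
      fun x : ℝ => Real.sqrt ν / Real.Gamma (1 - β / 2) * walkPhi μ ξ * x ^ (-(β / 2)) := by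
    have hΓ : 0 < Real.Gamma (1 - β / 2) := Real.Gamma_pos_of_pos (by linarith)
    have hs : 0 < Real.sqrt ν := Real.sqrt_pos.2 hν
    have hΦ : 0 < walkPhi μ ξ := Real.exp_pos _
    have h := (tendsto_rpow_mul_tail hm0 hα0 hα1 hL').div_const
      (walkPhi μ ξ * Real.sqrt ν / Real.Gamma (1 - β / 2))
    rw [div_self (by positivity)] at h
    refine isEquivalent_of_tendsto_one (h.congr' ?_)
    filter_upwards [eventually_gt_atTop 0] with x hx
    have hp : 0 < x ^ (β / 2) := Real.rpow_pos_of_pos hx _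
    rw [map_measureReal_apply hH measurableSet_Ioi, Pi.div_apply, Real.rpow_neg hx.le]
    simp only [Set.preimage, Set.mem_Ioi]
    field_simp
  refine ⟨hae, inStableDomain_of_laplace hm0 hα0 hα1 hc hL',
    ⟨summable_measureReal_walk_eq_zero hmeas hindep hident hpos, htail⟩, fun hint => ?_,
    fun hatom => ?_⟩
  · obtain ⟨h1, h2⟩ :=
      integrable_log_and_walkPhi_eq_latticePhi hmeas hindep hident hsymm hpos hint
    rw [h2] at htail
    exact ⟨h1, htail⟩
  · rw [walkPhi_eq_one_of_atomless hmeas hindep hident hatom] at htail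
    simpa only [mul_one] using htail
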